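/- Let $(\Sigma,g)$ be an oriented smooth Riemannian $3$-manifold with Levi-Civita connection $\nabla$. Let $S\Sigma\subset T\Sigma$ be its unit tangent sphere bundle and $\mathcal P$ the $\mathrm{SO}(3)$-bundle of oriented orthonormal frames $(e_1,e_2,e_3)$, projecting to $S\Sigma$ by $(e_1,e_2,e_3)\mapsto e_3$. Let $\phi^i(V)=g(e_i,\pi_*V)$ be the components of the canonical $1$-form on $\mathcal P$, and let $\omega^1,\omega^2,\omega^3$ be the components of the connection form, $$\omega=\begin{pmatrix}0&\omega^3&-\omega^2\\-\omega^3&0&\omega^1\\ \omega^2&-\omega^1&0\end{pmatrix},\qquad \omega_{ij}(V)=g(e_i,\nabla_Ve_j).$$ Put $G^{\mathrm F}=2(\phi^1\cdot\omega^1+\phi^2\cdot\omega^2+\phi^3\cdot\omega^3)$, where $(\varphi\cdot\psi)(V,W)=\frac12(\varphi(V)\psi(W)+\varphi(W)\psi(V))$, and let $K$ be the infinitesimal generator of the circle action $$(e_1,e_2,e_3)\mapsto(\cos\theta\, e_1-\sin\theta\, e_2,\ \sin\theta\, e_1+\cos\theta\, e_2,\ e_3)$$ on $\mathcal P$. Let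 $x(t)$, $a\le t\le b$ (with $a<b$), be a smooth regular curve on $\Sigma$, let $T=\dot x/|\dot x|$, and let $\tilde x(t)=(x(t),T(t))\in S\Sigma$ be its lift. Let $s\colon U\to\mathcal P$ be a smooth local section of $\mathcal P\to S\Sigma$ on an open set $U\subset S\Sigma$ containing the curve $\tilde x$. Let $$F(y,\xi)=\frac{G^{\mathrm F}(s_*\xi,s_*\xi)}{G^{\mathrm F}(K,s_*\xi)}\quad\text{(where }G^{\mathrm F}(K,s_*\xi)\neq0),\qquad \mathscr L[x]=\int_a^bF(\tilde x(t),\dot{\tilde x}(t))\,dt$$ be the Kropina metric associated with $s$ and the Kropina length functional. Write $s(\tilde x(a))=(e_1,e_2,T(a))$ and $s(\tilde x(b))=(e_1',e_2',T(b))$. Let $h\colon\dot x(a)^\perp\to\dot x(b)^\perp$ be the linear map with $h(e_i)=e_i'$ for $i=1,2$, and let $P\colon\dot x(a)^\perp\to\dot x(b)^\perp$ be the parallel transport along $x$ with respect to the normal connection $\nabla^\perp$ (the component of $\nabla$ orthogonal to $\dot x$). The total torsion $\mathscr T[x]\in\mathbb R/2\pi\mathbb Z$ with respect to these endpoint frames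 is the angle of the rotation $h^{-1}\circ P$ of the plane $\dot x(a)^\perp$, oriented by $(e_1,e_2)$. Then $G^{\mathrm F}(K,s_*\dot{\tilde x}(t))\ne0$ for all $t\in[a,b]$, the integral defining $\mathscr L[x]$ converges, the angle $\mathscr T[x]$ exists and is unique, and $$\mathscr L[x]\equiv2\,\mathscr T[x]\mod 2\pi\mathbb Z .$$ -/

import Mathlib

open Set Filter
open scoped Manifold ContDiff Topology

noncomputable section

namespace ConfThree

/-- The model space of a three-manifold. -/
abbrev E3 : Type := EuclideanSpace ℝ (Fin 3)

variable {M : Type*} [TopologicalSpace M] [ChartedSpace E3 M] [IsManifold (𝓡 3) ∞ M]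

/-- The tangent space `T_p M`. -/
abbrev Tan (p : M) : Type := TangentSpace (𝓡 3) p

variable (M) in
/-- The total space of the tangent bundle, with Mathlib's manifold structure. -/
abbrev TM : Type _ := TangentBundle (𝓡 3) M

variable (M) in
/-- A smooth Riemannian metric on the three-manifold `M`. -/
abbrev Metric3 : Type _ := Bundle.ContMDiffRiemannianMetric (𝓡 3) ∞ E3 (fun p : M => TangentSpace (𝓡 3) p)

variable (M) in
/-- An orientation of `M`: an orientation of every tangent space, locally constant in the
local trivializations of the tangent bundle given by the charts. -/
structure ManifoldOrientation where
  /-- the orientation of `T_p M` -/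
  orient (p : M) : Orientation ℝ (TangentSpace (𝓡 3) p) (Fin 3)
  locally_constant (p : M) : ∀ᶠ q in 𝓝 p,
    ∀ hq : q ∈ (trivializationAt E3 (fun p : M => TangentSpace (𝓡 3) p) p).baseSet,
      Orientation.map (Fin 3)
          ((trivializationAt E3 (fun p : M => TangentSpace (𝓡 3) p) p).linearEquivAt ℝ q hq)
          (orient q) =
        Orientation.map (Fin 3)
          ((trivializationAt E3 (fun p : M => TangentSpace (𝓡 3) p) p).linearEquivAt ℝ p
            (FiberBundle.mem_baseSet_trivializationAt' p))
          (orient p)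

/-! ### The Levi-Civita connection -/

/-- The metric read in the chart at `p`: the bilinear form `g_{ij}(y)` on the model space, for `y`
in the target of the chart. -/
def chartMetric (g : Metric3 M) (p : M) (y : E3) : E3 →L[ℝ] E3 →L[ℝ] ℝ :=
  let q : M := (extChartAt (𝓡 3) p).symm y
  let S : E3 →L[ℝ] TangentSpace (𝓡 3) q :=
    (trivializationAt E3 (fun p : M => TangentSpace (𝓡 3) p) p).symmL ℝ q
  (S.precomp ℝ) ∘L (g.inner q) ∘L S

theorem chartMetric_apply (g : Metric3 M) (p : M) (y v w : E3) :
    chartMetric g p y v w = g.inner ((extChartAt (𝓡 3) p).symm y)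
      ((trivializationAt E3 (fun p : M => TangentSpace (𝓡 3) p) p).symmL ℝ
        ((extChartAt (𝓡 3) p).symm y) v)
      ((trivializationAt E3 (fun p : M => TangentSpace (𝓡 3) p) p).symmL ℝ
        ((extChartAt (𝓡 3) p).symm y) w) := rfl

/-- The first derivatives of the metric coefficients at `p`, in the chart at `p`:
`chartMetricDeriv g p u v w` is `u^k v^i w^j ∂_k g_{ij}`. -/
def chartMetricDeriv (g : Metric3 M) (p : M) : E3 →L[ℝ] E3 →L[ℝ] E3 →L[ℝ] ℝ :=
  fderiv ℝ (chartMetric g p) (extChartAt (𝓡 3) p p)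

/-- Christoffel symbols of the first kind at `p` in the chart at `p`, as a linear form in the last
variable: `w ↦ (∂_u g(v, w) + ∂_v g(u, w) - ∂_w g(u, v)) / 2`. -/
def christoffelFirst (g : Metric3 M) (p : M) (u v : E3) : E3 →ₗ[ℝ] ℝ where
  toFun w := (chartMetricDeriv g p u v w + chartMetricDeriv g p v u w
    - chartMetricDeriv g p w u v) / 2
  map_add' w w' := by
    simp only [map_add, add_apply]
    ring
  map_smul' c w := by
    simp only [map_smul, smul_apply, smul_eq_mul, RingHom.id_apply]
    ring

instance (p : M) : FiniteDimensional ℝ (Tan p) :=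
  inferInstanceAs (FiniteDimensional ℝ E3)

/-- The map `v ↦ g(v, ·)` from `T_p M` to its dual. -/
def flat (g : Metric3 M) (p : M) : Tan p →ₗ[ℝ] Module.Dual ℝ (Tan p) where
  toFun v := (g.inner p v).toLinearMap
  map_add' v w := by ext; simp
  map_smul' c v := by ext; simp

theorem flat_injective (g : Metric3 M) (p : M) : Function.Injective (flat g p) := by
  rw [injective_iff_map_eq_zero]
  intro v hv
  by_contra h
  have h1 := g.pos p v h
  have h2 : g.inner p v v = 0 := congrArg (fun L => L v) hv
  exact absurd h2 h1.ne'

/-- The musical isomorphism `T_p M ≃ (T_p M)^*`. -/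
def flatEquiv (g : Metric3 M) (p : M) : Tan p ≃ₗ[ℝ] Module.Dual ℝ (Tan p) :=
  LinearMap.linearEquivOfInjective (flat g p) (flat_injective g p)
    Subspace.dual_finrank_eq.symm

/-- The Christoffel symbols `Γ(u, v) = Γ^k_{ij} u^i v^j` of `g` at `p`, in the chart at `p`. -/
def christoffel (g : Metric3 M) (p : M) (u v : Tan p) : Tan p :=
  (flatEquiv g p).symm (christoffelFirst g p u v)

theorem inner_christoffel (g : Metric3 M) (p : M) (u v w : Tan p) :
    g.inner p (christoffel g p u v) w =
      (chartMetricDeriv g p u v w + chartMetricDeriv g p v u w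
        - chartMetricDeriv g p w u v) / 2 := by
  have h : flat g p (christoffel g p u v) = christoffelFirst g p u v :=
    (flatEquiv g p).apply_symm_apply (christoffelFirst g p u v)
  exact congrArg (fun L => L w) h

/-- The covariant derivative of a vector field along a curve in `M`, from the coordinate velocities
in the chart at `p`: if at time `t` the curve is at `p` with velocity `xdot`, and the field has
value `v` and its components have derivative `vdot`, the result is `vdot + Γ(xdot, v)`. -/
def covFormula (g : Metric3 M) (p : M) (v : Tan p) (xdot vdot : E3) : Tan p :=
  (show Tan p from vdot) + christoffel g p xdot v

/-- The connector `T(TM) → TM` of the Levi-Civita connection. Mathlib represents a tangent vector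
`ξ` of `TM` at `v` by its coordinates in the chart of `TM` induced by the chart of `M` at the base
point of `v`: `ξ.1` is the velocity of the base point, `ξ.2` that of the fibre coordinates. -/
def connector (g : Metric3 M) (v : TM M) (ξ : TangentSpace (𝓡 3).tangent v) : Tan v.proj :=
  covFormula g v.proj v.snd (show E3 × E3 from ξ).1 (show E3 × E3 from ξ).2

/-! ### Curves -/

/-- The velocity `ẋ(t)` of a curve defined on `[a, b]` (one-sided at the endpoints). -/
def velocity (x : ℝ → M) (a b t : ℝ) : Tan (x t) :=
  mfderivWithin 𝓘(ℝ) (𝓡 3) x (Icc a b) t (1 : ℝ)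

/-- A smooth regular curve `x(t)`, `a ≤ t ≤ b`. -/
structure IsRegularCurve (x : ℝ → M) (a b : ℝ) : Prop where
  lt : a < b
  smooth : ContMDiffOn 𝓘(ℝ) (𝓡 3) ∞ x (Icc a b)
  velocity_ne_zero : ∀ t ∈ Icc a b, velocity x a b t ≠ 0

/-- The length `|v|` of a tangent vector. -/
def length (g : Metric3 M) (p : M) (v : Tan p) : ℝ := √(g.inner p v v)

/-- The unit tangent vector `T(t) = ẋ(t) / |ẋ(t)|`. -/
def unitTangent (g : Metric3 M) (x : ℝ → M) (a b t : ℝ) : Tan (x t) :=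
  (length g (x t) (velocity x a b t))⁻¹ • velocity x a b t

/-- The unit tangent sphere bundle `SM`, as a submanifold of `TM`. -/
def unitSphereBundle (g : Metric3 M) : Set (TM M) := {v | g.inner v.proj v.snd v.snd = 1}

/-- The lift `x̃(t) = (x(t), ẋ(t) / |ẋ(t)|)` of a curve to the unit tangent sphere bundle. -/
def lift (g : Metric3 M) (x : ℝ → M) (a b t : ℝ) : TM M := ⟨x t, unitTangent g x a b t⟩

/-- The velocity of the lift `x̃`. -/
def liftVelocity (g : Metric3 M) (x : ℝ → M) (a b t : ℝ) :
    TangentSpace (𝓡 3).tangent (lift g x a b t) :=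
  mfderivWithin 𝓘(ℝ) (𝓡 3).tangent (lift g x a b) (Icc a b) t (1 : ℝ)

/-! ### The frame bundle and the Fefferman metric on it -/

/-- The bundle of triples of tangent vectors with a common base point. -/
abbrev TripleFiber (p : M) : Type :=
  TangentSpace (𝓡 3) p × TangentSpace (𝓡 3) p × TangentSpace (𝓡 3) p

variable (M) in
/-- The total space of the Whitney sum `TM ⊕ TM ⊕ TM`, with Mathlib's manifold structure. The frame
bundle is a submanifold of it. -/
abbrev Triples : Type _ :=
  Bundle.TotalSpace (E3 × E3 × E3) (fun p : M =>
    TangentSpace (𝓡 3) p × TangentSpace (𝓡 3) p × TangentSpace (𝓡 3) p)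

/-- The model with corners (without boundary) of `TM ⊕ TM ⊕ TM`. -/
abbrev modelTriples : ModelWithCorners ℝ (E3 × (E3 × E3 × E3)) (ModelProd E3 (E3 × E3 × E3)) :=
  (𝓡 3).prod 𝓘(ℝ, E3 × E3 × E3)

/-- The vectors `e_1, e_2, e_3` of a triple. -/
def vec {p : M} (e : TripleFiber p) : Fin 3 → Tan p := ![e.1, e.2.1, e.2.2]

/-- `e = (e_1, e_2, e_3)` is an oriented orthonormal frame of `T_p M`. -/
def IsOrientedFrame (g : Metric3 M) (o : ManifoldOrientation M) (p : M) (e : TripleFiber p) :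
    Prop :=
  (∀ i j, g.inner p (vec e i) (vec e j) = if i = j then 1 else 0) ∧
    ∃ b : Module.Basis (Fin 3) ℝ (TangentSpace (𝓡 3) p), ⇑b = vec e ∧ b.orientation = o.orient p

/-- The bundle `𝒫` of oriented orthonormal frames. -/
def frameBundle (g : Metric3 M) (o : ManifoldOrientation M) : Set (Triples M) :=
  {u | IsOrientedFrame g o u.proj u.snd}

/-- The velocity of the base point of a tangent vector of `TM ⊕ TM ⊕ TM`. -/
def baseVel {u : Triples M} (V : TangentSpace modelTriples u) : Tan u.proj :=
  (show E3 × (E3 × E3 × E3) from V).1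

/-- The velocity of the `j`-th vector of a triple, in the fibre coordinates given by the chart of
`M` at the base point. -/
def fiberVel {u : Triples M} (V : TangentSpace modelTriples u) : Fin 3 → E3 :=
  let W : E3 × (E3 × E3 × E3) := V
  ![W.2.1, W.2.2.1, W.2.2.2]

/-- The canonical one-form `φ = (φ^1, φ^2, φ^3)` on the frame bundle:
`φ^i(V) = g(e_i, π_* V)` at the frame `(e_1, e_2, e_3)`. -/
def canonicalForm (g : Metric3 M) (u : Triples M) (V : TangentSpace modelTriples u) (i : Fin 3) :
    ℝ :=
  g.inner u.proj (vec u.snd i) (baseVel V)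

/-- The Levi-Civita connection form, as a matrix: the entry in row `i` and column `j` is
`g(e_i, ∇_V e_j)`. -/
def connectionMatrix (g : Metric3 M) (u : Triples M) (V : TangentSpace modelTriples u) :
    Matrix (Fin 3) (Fin 3) ℝ :=
  Matrix.of fun i j =>
    g.inner u.proj (vec u.snd i) (covFormula g u.proj (vec u.snd j) (baseVel V) (fiberVel V j))

/-- The components `ω^1, ω^2, ω^3` of the connection form, where the matrix `ω` has first row
`(0, ω^3, -ω^2)`, second row `(-ω^3, 0, ω^1)` and third row `(ω^2, -ω^1, 0)`. -/
def connectionForm (g : Metric3 M) (u : Triples M) (V : TangentSpace modelTriples u) : Fin 3 → ℝ :=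
  ![connectionMatrix g u V 1 2, connectionMatrix g u V 2 0, connectionMatrix g u V 0 1]

/-- The Fefferman metric `G = 2 (φ^1 · ω^1 + φ^2 · ω^2 + φ^3 · ω^3)` on the frame bundle, with the
symmetric product `(φ · ψ)(V, W) = (φ(V) ψ(W) + φ(W) ψ(V)) / 2` of one-forms. -/
def fefferman (g : Metric3 M) (u : Triples M) (V W : TangentSpace modelTriples u) : ℝ :=
  2 * ∑ i, (canonicalForm g u V i * connectionForm g u W i
    + canonicalForm g u W i * connectionForm g u V i) / 2

/-- The action of the circle on frames, which rotates the first two vectors. It corresponds to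
`ζ ↦ e^{iθ} ζ` for `ζ = (e_1 + i e_2) / √2`. -/
def rotateFrame (u : Triples M) (θ : ℝ) : Triples M :=
  ⟨u.proj, (Real.cos θ • u.snd.1 - Real.sin θ • u.snd.2.1,
    Real.sin θ • u.snd.1 + Real.cos θ • u.snd.2.1, u.snd.2.2)⟩

theorem rotateFrame_zero (u : Triples M) : rotateFrame u 0 = u := by
  simp [rotateFrame]

/-- The infinitesimal generator `K` of the circle action. -/
def generator (u : Triples M) : TangentSpace modelTriples u :=
  rotateFrame_zero u ▸ mfderiv 𝓘(ℝ) modelTriples (rotateFrame u) 0 (1 : ℝ)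

/-! ### Sections, the Kropina metric and the functional -/

/-- The map `TM → TM ⊕ TM ⊕ TM` over `M` given by the family `s` of triples. -/
def sectionMap (s : ∀ v : TM M, TripleFiber v.proj) (v : TM M) : Triples M := ⟨v.proj, s v⟩

/-- `s` is a smooth section, over the open subset `U ∩ SM` of the unit tangent sphere bundle `SM`,
of the projection `𝒫 → SM`, `(e_1, e_2, e_3) ↦ e_3`. (Values of `s` outside `U ∩ SM` are
irrelevant.) -/
structure IsLocalSection (g : Metric3 M) (o : ManifoldOrientation M) (U : Set (TM M))
    (s : ∀ v : TM M, TripleFiber v.proj) : Prop where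
  isOpen : IsOpen U
  mem_frameBundle : ∀ v ∈ U ∩ unitSphereBundle g, sectionMap s v ∈ frameBundle g o
  third : ∀ v ∈ U ∩ unitSphereBundle g, (s v).2.2 = v.snd
  smooth : ContMDiffOn (𝓡 3).tangent modelTriples ∞ (sectionMap s) (U ∩ unitSphereBundle g)

/-- The push-forward `s_* ξ` of a vector `ξ` tangent to `SM` by a section over `U ∩ SM`. -/
def sectionPush (g : Metric3 M) (U : Set (TM M)) (s : ∀ v : TM M, TripleFiber v.proj) (y : TM M)
    (ξ : TangentSpace (𝓡 3).tangent y) : TangentSpace modelTriples (sectionMap s y) :=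
  mfderivWithin (𝓡 3).tangent modelTriples (sectionMap s) (U ∩ unitSphereBundle g) y ξ

/-- The denominator `G(K, s_* ξ)` of the Kropina metric. The Kropina metric is defined at `ξ` when
this is non-zero. -/
def kropinaDenom (g : Metric3 M) (U : Set (TM M)) (s : ∀ v : TM M, TripleFiber v.proj) (y : TM M)
    (ξ : TangentSpace (𝓡 3).tangent y) : ℝ :=
  fefferman g (sectionMap s y) (generator (sectionMap s y)) (sectionPush g U s y ξ)

/-- The Kropina metric `F(y, ξ) = G(s_* ξ, s_* ξ) / G(K, s_* ξ)`. -/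
def kropina (g : Metric3 M) (U : Set (TM M)) (s : ∀ v : TM M, TripleFiber v.proj) (y : TM M)
    (ξ : TangentSpace (𝓡 3).tangent y) : ℝ :=
  fefferman g (sectionMap s y) (sectionPush g U s y ξ) (sectionPush g U s y ξ) /
    kropinaDenom g U s y ξ

/-- The functional `ℒ[x] = ∫_a^b F(x̃(t), x̃'(t)) dt`. -/
def kropinaLength (g : Metric3 M) (U : Set (TM M)) (s : ∀ v : TM M, TripleFiber v.proj)
    (x : ℝ → M) (a b : ℝ) : ℝ :=
  ∫ t in a..b, kropina g U s (lift g x a b t) (liftVelocity g x a b t)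

/-! ### The total torsion -/

/-- The covariant derivative `∇_ẋ ν` of a vector field `ν` along a curve. -/
def covDeriv (g : Metric3 M) (x : ℝ → M) (a b : ℝ) (ν : ∀ t, Tan (x t)) (t : ℝ) : Tan (x t) :=
  connector g (⟨x t, ν t⟩ : TM M)
    (mfderivWithin 𝓘(ℝ) (𝓡 3).tangent (fun r => (⟨x r, ν r⟩ : TM M)) (Icc a b) t (1 : ℝ))

/-- The normal covariant derivative `∇^⊥_ẋ ν`, the component of `∇_ẋ ν` orthogonal to `ẋ`. -/
def normalCovDeriv (g : Metric3 M) (x : ℝ → M) (a b : ℝ) (ν : ∀ t, Tan (x t)) (t : ℝ) :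
    Tan (x t) :=
  covDeriv g x a b ν t
    - g.inner (x t) (covDeriv g x a b ν t) (unitTangent g x a b t) • unitTangent g x a b t

/-- The normal space `ẋ(t)^⊥`. -/
def normalSpace (g : Metric3 M) (x : ℝ → M) (a b t : ℝ) : Submodule ℝ (Tan (x t)) :=
  LinearMap.ker (g.inner (x t) (velocity x a b t)).toLinearMap

/-- A normal field along `x` (of class `C^1`, hence smooth), parallel for the normal connection. -/
structure IsNormalParallel (g : Metric3 M) (x : ℝ → M) (a b : ℝ) (ν : ∀ t, Tan (x t)) : Prop where
  contMDiff : ContMDiffOn 𝓘(ℝ) (𝓡 3).tangent 1 (fun t => (⟨x t, ν t⟩ : TM M)) (Icc a b)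
  normal : ∀ t ∈ Icc a b, ν t ∈ normalSpace g x a b t
  parallel : ∀ t ∈ Icc a b, normalCovDeriv g x a b ν t = 0

/-- `P : ẋ(a)^⊥ → ẋ(b)^⊥` is the parallel transport along `x` for the normal connection. -/
def IsNormalTransport (g : Metric3 M) (x : ℝ → M) (a b : ℝ)
    (P : normalSpace g x a b a →ₗ[ℝ] normalSpace g x a b b) : Prop :=
  ∀ v : normalSpace g x a b a, ∃ ν : ∀ t, Tan (x t), IsNormalParallel g x a b ν ∧ ν a = v.1 ∧ ν b = (P v).1

/-- `h : ẋ(a)^⊥ → ẋ(b)^⊥` is the linear isomorphism with `h(e_i) = e_i'` for `i = 1, 2`, where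
`A = (e_1, e_2, T(a))` and `B = (e_1', e_2', T(b))`. -/
def IsMonodromy (g : Metric3 M) (x : ℝ → M) (a b : ℝ) (A : TripleFiber (x a))
    (B : TripleFiber (x b)) (h : normalSpace g x a b a ≃ₗ[ℝ] normalSpace g x a b b) : Prop :=
  (∃ v : normalSpace g x a b a, v.1 = A.1 ∧ (h v).1 = B.1) ∧
    (∃ v : normalSpace g x a b a, v.1 = A.2.1 ∧ (h v).1 = B.2.1)

/-- `R` is the rotation by the angle `θ` of the plane `ẋ(a)^⊥`, oriented by the first two vectors of
`A = (e_1, e_2, T(a))`. -/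
def IsRotation (g : Metric3 M) (x : ℝ → M) (a b : ℝ) (A : TripleFiber (x a)) (θ : Real.Angle)
    (R : normalSpace g x a b a →ₗ[ℝ] normalSpace g x a b a) : Prop :=
  (∃ v : normalSpace g x a b a, v.1 = A.1 ∧ (R v).1 = θ.cos • A.1 + θ.sin • A.2.1) ∧
    (∃ v : normalSpace g x a b a, v.1 = A.2.1 ∧ (R v).1 = -θ.sin • A.1 + θ.cos • A.2.1)

/-- `θ ∈ ℝ/2πℤ` is the angle of the rotation `h⁻¹ ∘ P` of `ẋ(a)^⊥`. -/
def IsTotalTorsion (g : Metric3 M) (x : ℝ → M) (a b : ℝ) (A : TripleFiber (x a))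
    (B : TripleFiber (x b)) (θ : Real.Angle) : Prop :=
  ∃ (h : normalSpace g x a b a ≃ₗ[ℝ] normalSpace g x a b b)
    (P : normalSpace g x a b a →ₗ[ℝ] normalSpace g x a b b),
    IsMonodromy g x a b A B h ∧ IsNormalTransport g x a b P ∧
      IsRotation g x a b A θ (h.symm.toLinearMap ∘ₗ P)

/-- The total torsion `𝒯[x] = h⁻¹ ∘ P ∈ SO(ẋ(a)^⊥) ≅ ℝ/2πℤ`, with respect to the frames `A` and `B`
at the endpoints. -/
def totalTorsion (g : Metric3 M) (x : ℝ → M) (a b : ℝ) (A : TripleFiber (x a))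
    (B : TripleFiber (x b)) : Real.Angle :=
  Classical.epsilon (IsTotalTorsion g x a b A B)

end ConfThree

end

set_option maxSynthPendingDepth 3

noncomputable section

namespace ConfThree

variable {M : Type*} [TopologicalSpace M] [ChartedSpace E3 M] [IsManifold (𝓡 3) ∞ M]

/-! Along the lift, the section gives an orthonormal frame `(e_1, e_2, T)` over `x`; let `V` be its
velocity in the frame bundle. Since `ẋ = |ẋ| T`, one has `φ(V) = (0, 0, |ẋ|)`. The generator `K` is
vertical, with `φ(K) = 0` and `ω(K) = (0, 0, 1)`. Hence `G(K, V) = |ẋ|`, which is positive, and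
`G(V, V) = 2 |ẋ| ω^3(V)`, so that `F = 2 ω^3(V) = 2 g(e_1, ∇_ẋ e_2)` (`kropina_section`).

On the other side, write a normal field as `A e_1 + B e_2` and put `ρ = g(e_1, ∇_ẋ e_2)`. It is
parallel for the normal connection exactly when `A' = -ρ B` and `B' = ρ A`, so its coefficients turn
by the angle `∫ ρ` (`parallel_right`, `exists_parallel`). The map `h` identifies the two endpoint
frames, therefore `h⁻¹ ∘ P` is the rotation by `∫ ρ` (`isTotalTorsion_iff`), and the Kropina length
is twice this angle.

The analytic groundwork is that the covariant derivative, defined at each point in the chart centred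
there, has the same expression in any fixed chart (`inner_connector`). This yields compatibility
with the metric and continuity of `ρ`. -/

/-! ### Change of coordinates for metrics on a normed space -/

section Calculus

variable {E : Type*} [NormedAddCommGroup E] [NormedSpace ℝ E]

/-- The derivative of the coefficients of a metric which is the pull-back of another one. -/
theorem fderiv_pullback_metric {G H : E → E →L[ℝ] E →L[ℝ] ℝ} {σ : E → E} {y : E}
    (hG : DifferentiableAt ℝ G y) (hH : DifferentiableAt ℝ H (σ y)) (hσ : ContDiffAt ℝ 2 σ y)
    (hpull : ∀ᶠ z in 𝓝 y, ∀ v w, G z v w = H (σ z) (fderiv ℝ σ z v) (fderiv ℝ σ z w))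
    (u v w : E) :
    fderiv ℝ G y u v w =
      fderiv ℝ H (σ y) (fderiv ℝ σ y u) (fderiv ℝ σ y v) (fderiv ℝ σ y w)
      + H (σ y) (fderiv ℝ (fderiv ℝ σ) y u v) (fderiv ℝ σ y w)
      + H (σ y) (fderiv ℝ σ y v) (fderiv ℝ (fderiv ℝ σ) y u w) := by
  have hσ1 : HasFDerivAt σ (fderiv ℝ σ y) y :=
    (hσ.differentiableAt two_ne_zero).hasFDerivAt
  have hσ2 : HasFDerivAt (fderiv ℝ σ) (fderiv ℝ (fderiv ℝ σ) y) y :=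
    ((hσ.fderiv_right (m := 1) le_rfl).differentiableAt one_ne_zero).hasFDerivAt
  have hc (v : E) := hσ2.clm_apply (hasFDerivAt_const v y)
  have h1 := (hG.hasFDerivAt.clm_apply (hasFDerivAt_const v y)).clm_apply (hasFDerivAt_const w y)
  have hHσ : HasFDerivAt (fun z => H (σ z)) ((fderiv ℝ H (σ y)).comp (fderiv ℝ σ y)) y :=
    HasFDerivAt.comp (g := H) y hH.hasFDerivAt hσ1
  have h2 := (hHσ.clm_apply (hc v)).clm_apply (hc w)
  -- With `v` and `w` frozen, both sides are differentiated at `y`; the right side also varies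
  -- through `fderiv ℝ σ`, which produces the two second-derivative terms.
  have h3 := h1.unique (h2.congr_of_eventuallyEq (hpull.mono fun z hz => hz v w))
  have h4 := congrArg (fun L => L u) h3
  simp at h4
  rw [h4]
  ring

/-- The quantity `G(v̇ + Γ(u, v), w)`, where `Γ` are the Christoffel symbols of the metric `G` at
`y`. -/
def coordCov (G : E → E →L[ℝ] E →L[ℝ] ℝ) (y u v vdot w : E) : ℝ :=
  G y vdot w + (fderiv ℝ G y u v w + fderiv ℝ G y v u w - fderiv ℝ G y w u v) / 2

/-- Covariance of the covariant derivative under a change of coordinates. -/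
theorem coordCov_pullback {G H : E → E →L[ℝ] E →L[ℝ] ℝ} {σ : E → E} {y : E}
    (hG : DifferentiableAt ℝ G y) (hH : DifferentiableAt ℝ H (σ y)) (hσ : ContDiffAt ℝ 2 σ y)
    (hsymm : ∀ v w, H (σ y) v w = H (σ y) w v)
    (hpull : ∀ᶠ z in 𝓝 y, ∀ v w, G z v w = H (σ z) (fderiv ℝ σ z v) (fderiv ℝ σ z w))
    (u v vdot w : E) :
    coordCov G y u v vdot w = coordCov H (σ y) (fderiv ℝ σ y u) (fderiv ℝ σ y v)
      (fderiv ℝ (fderiv ℝ σ) y u v + fderiv ℝ σ y vdot) (fderiv ℝ σ y w) := by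
  -- By symmetry of the second derivative and of `H`, the second-derivative terms cancel except
  -- `H(D²σ(u, v), Dσ w)`, which is the correction to the transformed `vdot`.
  have hs : IsSymmSndFDerivAt ℝ σ y := hσ.isSymmSndFDerivAt (by simp)
  simp only [coordCov, fderiv_pullback_metric hG hH hσ hpull, hpull.self_of_nhds vdot w, map_add,
    add_apply]
  rw [hs.eq v u, hs.eq w u, hs.eq w v, hsymm (fderiv ℝ σ y u) (fderiv ℝ (fderiv ℝ σ) y v w),
    hsymm (fderiv ℝ σ y v) (fderiv ℝ (fderiv ℝ σ) y u w)]
  ring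

/-- Compatibility of the covariant derivative with the metric. -/
theorem hasDerivWithinAt_metric_apply {G : E → E →L[ℝ] E →L[ℝ] ℝ} {y v w : ℝ → E} {u v' w' : E}
    {S : Set ℝ} {t : ℝ} (hG : DifferentiableAt ℝ G (y t))
    (hsymm : ∀ᶠ z in 𝓝 (y t), ∀ v w, G z v w = G z w v)
    (hy : HasDerivWithinAt y u S t) (hv : HasDerivWithinAt v v' S t)
    (hw : HasDerivWithinAt w w' S t) :
    HasDerivWithinAt (fun r => G (y r) (v r) (w r))
      (coordCov G (y t) u (v t) v' (w t) + coordCov G (y t) u (w t) w' (v t)) S t := by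
  have hGy : HasDerivWithinAt (fun r => G (y r)) (fderiv ℝ G (y t) u) S t :=
    HasFDerivAt.comp_hasDerivWithinAt (l := G) t hG.hasFDerivAt hy
  have h1 := (hGy.clm_apply hv).clm_apply hw
  refine h1.congr_deriv ?_
  -- The derivative of a family of symmetric forms is symmetric, so the two Christoffel
  -- contributions add up to the derivative of `G` along `u`, applied to `v` and `w`.
  have hd (a b c : E) : fderiv ℝ G (y t) a b c = fderiv ℝ G (y t) a c b := by
    have h2 := (hG.hasFDerivAt.clm_apply (hasFDerivAt_const b (y t))).clm_apply
      (hasFDerivAt_const c (y t))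
    have h3 := (hG.hasFDerivAt.clm_apply (hasFDerivAt_const c (y t))).clm_apply
      (hasFDerivAt_const b (y t))
    have h4 := congrArg (fun L => L a)
      (h2.unique (h3.congr_of_eventuallyEq (hsymm.mono fun z hz => hz b c)))
    simpa using h4
  simp only [coordCov, add_apply]
  rw [hsymm.self_of_nhds w' (v t), hd u (w t) (v t), hd (v t) u (w t), hd (w t) u (v t)]
  ring

theorem continuousWithinAt_coordCov {G : E → E →L[ℝ] E →L[ℝ] ℝ} {y u v v' w : ℝ → E}
    {S : Set ℝ} {t : ℝ} (hG : ContDiffAt ℝ 1 G (y t)) (hy : ContinuousWithinAt y S t)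
    (hu : ContinuousWithinAt u S t) (hv : ContinuousWithinAt v S t)
    (hv' : ContinuousWithinAt v' S t) (hw : ContinuousWithinAt w S t) :
    ContinuousWithinAt (fun r => coordCov G (y r) (u r) (v r) (v' r) (w r)) S t := by
  have h0 : ContinuousWithinAt (fun r => G (y r)) S t :=
    ContinuousAt.comp_continuousWithinAt (g := G) hG.continuousAt hy
  have h1 : ContinuousWithinAt (fun r => fderiv ℝ G (y r)) S t :=
    ContinuousAt.comp_continuousWithinAt (g := fderiv ℝ G)
      (hG.fderiv_right (m := 0) le_rfl).continuousAt hy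
  exact ((h0.clm_apply hv').clm_apply hw).add
    (((((h1.clm_apply hu).clm_apply hv).clm_apply hw).add
      (((h1.clm_apply hv).clm_apply hu).clm_apply hw)).sub
      (((h1.clm_apply hw).clm_apply hu).clm_apply hv) |>.div_const 2)

end Calculus

/-! ### Charts -/

/-- The fibre coordinates of a tangent vector in the chart at `p`. -/
def fibreCoord (p : M) (z : TM M) : E3 :=
  (trivializationAt E3 (fun p : M => TangentSpace (𝓡 3) p) p z).2

theorem fibreCoord_self (z : TM M) : fibreCoord z.1 z = z.2 :=
  tangentCoordChange_self (mem_extChartAt_source z.1)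

/-- Fibre coordinates are by definition the coordinate change from the chart centred at `q`, so this
is the cocycle identity. -/
theorem fibreCoord_transition {p p₀ q : M} (hq : q ∈ (chartAt E3 p).source)
    (hq₀ : q ∈ (chartAt E3 p₀).source) (v : Tan q) :
    fibreCoord p₀ (⟨q, v⟩ : TM M)
      = tangentCoordChange (𝓡 3) p p₀ q (fibreCoord p (⟨q, v⟩ : TM M)) := by
  refine (tangentCoordChange_comp (I := 𝓡 3) ⟨⟨mem_extChartAt_source q, ?_⟩, ?_⟩).symm
  · rwa [extChartAt_source]
  · rwa [extChartAt_source]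

theorem fibreCoord_symmL {p q : M} (hq : q ∈ (chartAt E3 p).source) (v : E3) :
    fibreCoord p (⟨q, (trivializationAt E3 (fun p : M => TangentSpace (𝓡 3) p) p).symmL ℝ q v⟩ :
      TM M) = v := by
  have h := (trivializationAt E3 (fun p : M => TangentSpace (𝓡 3) p) p).continuousLinearMapAt_symmL
    (R := ℝ) (b := q) hq v
  rwa [Bundle.Trivialization.continuousLinearMapAt_apply_of_mem (R := ℝ) _ hq] at h

theorem symmL_fibreCoord {p q : M} (hq : q ∈ (chartAt E3 p).source) (v : Tan q) :
    (trivializationAt E3 (fun p : M => TangentSpace (𝓡 3) p) p).symmL ℝ q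
      (fibreCoord p (⟨q, v⟩ : TM M)) = v := by
  have h := (trivializationAt E3 (fun p : M => TangentSpace (𝓡 3) p) p).symmL_continuousLinearMapAt
    (R := ℝ) (b := q) hq v
  rwa [Bundle.Trivialization.continuousLinearMapAt_apply_of_mem (R := ℝ) _ hq] at h

theorem inner_eq_chartMetric (g : Metric3 M) {p q : M} (hq : q ∈ (chartAt E3 p).source)
    (v w : Tan q) :
    g.inner q v w = chartMetric g p (extChartAt (𝓡 3) p q) (fibreCoord p (⟨q, v⟩ : TM M))
      (fibreCoord p (⟨q, w⟩ : TM M)) := by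
  have h : (extChartAt (𝓡 3) p).symm (extChartAt (𝓡 3) p q) = q :=
    (extChartAt (𝓡 3) p).left_inv (by rwa [extChartAt_source])
  rw [chartMetric_apply, h, symmL_fibreCoord hq, symmL_fibreCoord hq]

theorem chartMetric_symm (g : Metric3 M) (p : M) (y v w : E3) :
    chartMetric g p y v w = chartMetric g p y w v := by
  rw [chartMetric_apply, chartMetric_apply, g.symm]

/-- The transition function between the charts at `p` and `p₀`. -/
def chartTransition (p p₀ : M) : E3 → E3 := extChartAt (𝓡 3) p₀ ∘ (extChartAt (𝓡 3) p).symm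

omit [IsManifold (𝓡 3) ∞ M] in
theorem chartTransition_apply {p p₀ q : M} (hq : q ∈ (chartAt E3 p).source) :
    chartTransition p p₀ (extChartAt (𝓡 3) p q) = extChartAt (𝓡 3) p₀ q :=
  congrArg (extChartAt (𝓡 3) p₀)
    ((extChartAt (𝓡 3) p).left_inv (by rwa [extChartAt_source]))

theorem contDiffAt_chartTransition {p p₀ q : M} (hq : q ∈ (chartAt E3 p).source)
    (hq₀ : q ∈ (chartAt E3 p₀).source) :
    ContDiffAt ℝ ∞ (chartTransition p p₀) (extChartAt (𝓡 3) p q) := by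
  have h := contDiffWithinAt_ext_coord_change (n := ∞) (I := 𝓡 3) p₀ p
    (y := extChartAt (𝓡 3) p q) (by
      rw [PartialEquiv.trans_source'', PartialEquiv.symm_symm, PartialEquiv.symm_target]
      exact mem_image_of_mem _ ⟨by rwa [extChartAt_source], by rwa [extChartAt_source]⟩)
  simpa [chartTransition, contDiffWithinAt_univ] using h

theorem fderiv_chartTransition {p p₀ q : M} :
    fderiv ℝ (chartTransition p p₀) (extChartAt (𝓡 3) p q)
      = tangentCoordChange (𝓡 3) p p₀ q := by
  rw [tangentCoordChange_def]
  simp [chartTransition]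

/-- The identity is needed on a whole neighbourhood because `coordCov_pullback` differentiates it.
-/
theorem eventually_chartMetric_transition (g : Metric3 M) {p p₀ q : M}
    (hq : q ∈ (chartAt E3 p).source) (hq₀ : q ∈ (chartAt E3 p₀).source) :
    ∀ᶠ z in 𝓝 (extChartAt (𝓡 3) p q), ∀ v w, chartMetric g p z v w =
      chartMetric g p₀ (chartTransition p p₀ z) (fderiv ℝ (chartTransition p p₀) z v)
        (fderiv ℝ (chartTransition p p₀) z w) := by
  have h1 : ∀ᶠ z in 𝓝 (extChartAt (𝓡 3) p q), z ∈ (extChartAt (𝓡 3) p).target :=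
    extChartAt_target_mem_nhds' (I := 𝓡 3) (by
      exact (extChartAt (𝓡 3) p).map_source (by rwa [extChartAt_source]))
  have h2 : ∀ᶠ z in 𝓝 (extChartAt (𝓡 3) p q),
      (extChartAt (𝓡 3) p).symm z ∈ (chartAt E3 p₀).source := by
    have hc : ContinuousAt (extChartAt (𝓡 3) p).symm (extChartAt (𝓡 3) p q) :=
      continuousAt_extChartAt_symm' (by rwa [extChartAt_source])
    refine hc.preimage_mem_nhds ((chartAt E3 p₀).open_source.mem_nhds ?_)
    rwa [(extChartAt (𝓡 3) p).left_inv (by rwa [extChartAt_source])]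
  filter_upwards [h1, h2] with z hz1 hz2 v w
  have hs : (extChartAt (𝓡 3) p).symm z ∈ (chartAt E3 p).source := by
    rw [← extChartAt_source (𝓡 3)]
    exact (extChartAt (𝓡 3) p).map_target hz1
  have hz : extChartAt (𝓡 3) p ((extChartAt (𝓡 3) p).symm z) = z :=
    (extChartAt (𝓡 3) p).right_inv hz1
  -- Naming the point allows `z` to be replaced by the chart image of `q'`, where the formulas at
  -- points of the manifold apply.
  obtain ⟨q', hq'⟩ : ∃ q', (extChartAt (𝓡 3) p).symm z = q' := ⟨_, rfl⟩
  rw [hq'] at hs hz hz2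
  subst hz
  have key (v : E3) := fibreCoord_transition hs hz2
    ((trivializationAt E3 (fun p : M => TangentSpace (𝓡 3) p) p).symmL ℝ q' v)
  simp only [fibreCoord_symmL hs] at key
  rw [chartTransition_apply hs, fderiv_chartTransition, ← key, ← key, ← inner_eq_chartMetric g hz2,
    inner_eq_chartMetric g hs, fibreCoord_symmL hs, fibreCoord_symmL hs]

/-- In finite dimension it suffices to test the form on constant vectors `v`, `w`; these correspond
to smooth local sections of the tangent bundle, on which `g` is smooth. -/
theorem contDiffAt_chartMetric (g : Metric3 M) {p q : M} (hq : q ∈ (chartAt E3 p).source) :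
    ContDiffAt ℝ ∞ (chartMetric g p) (extChartAt (𝓡 3) p q) := by
  have hsymm : ContMDiffOn 𝓘(ℝ, E3) (𝓡 3) ∞ (extChartAt (𝓡 3) p).symm (extChartAt (𝓡 3) p).target :=
    contMDiffOn_extChartAt_symm p
  have hmaps : ∀ y ∈ (extChartAt (𝓡 3) p).target,
      (extChartAt (𝓡 3) p).symm y ∈ (chartAt E3 p).source := fun y hy => by
    rw [← extChartAt_source (𝓡 3)]
    exact (extChartAt (𝓡 3) p).map_target hy
  have hv (v : E3) : ContMDiffOn 𝓘(ℝ, E3) (𝓡 3).tangent ∞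
      (fun y => (⟨(extChartAt (𝓡 3) p).symm y,
        (trivializationAt E3 (fun p : M => TangentSpace (𝓡 3) p) p).symmL ℝ
          ((extChartAt (𝓡 3) p).symm y) v⟩ : TM M)) (extChartAt (𝓡 3) p).target := by
    have h1 := (Bundle.Trivialization.contMDiffOn_symm (n := ∞) (IB := 𝓡 3)
      (trivializationAt E3 (fun p : M => TangentSpace (𝓡 3) p) p)).comp
      (hsymm.prodMk (contMDiffOn_const (c := v))) (fun y hy => by
        rw [Set.mem_preimage, Bundle.Trivialization.target_eq]
        exact ⟨hmaps y hy, mem_univ _⟩)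
    refine h1.congr fun y hy => ?_
    rw [Bundle.Trivialization.symmL_apply _ (hmaps y hy)]
    exact Bundle.Trivialization.mk_symm
      (trivializationAt E3 (fun p : M => TangentSpace (𝓡 3) p) p) (hmaps y hy) v
  have hbil (v w : E3) : ContDiffOn ℝ ∞ (fun y => chartMetric g p y v w)
      (extChartAt (𝓡 3) p).target := by
    rw [← contMDiffOn_iff_contDiffOn]
    intro y hy
    have h := ContMDiffWithinAt.clm_bundle_apply₂ (F₁ := E3) (F₂ := E3) (F₃ := ℝ)
      (E₃ := Bundle.Trivial M ℝ)
      (g.contMDiff.contMDiffAt.comp_contMDiffWithinAt y (hsymm y hy)) (hv v y hy) (hv w y hy)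
    simp only [Bundle.contMDiffWithinAt_totalSpace] at h
    exact h.2
  have hon : ContDiffOn ℝ ∞ (chartMetric g p) (extChartAt (𝓡 3) p).target :=
    contDiffOn_clm_apply.2 fun v => contDiffOn_clm_apply.2 fun w => hbil v w
  have hmem : extChartAt (𝓡 3) p q ∈ (extChartAt (𝓡 3) p).target :=
    (extChartAt (𝓡 3) p).map_source (by rwa [extChartAt_source])
  exact hon.contDiffAt (extChartAt_target_mem_nhds' (I := 𝓡 3) hmem)

/-! ### The covariant derivative along a curve in an arbitrary chart -/

theorem inner_covFormula (g : Metric3 M) (p : M) (v : Tan p) (u v' : E3) (w : Tan p) :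
    g.inner p (covFormula g p v u v') w =
      coordCov (chartMetric g p) (extChartAt (𝓡 3) p p) u v v' w := by
  have h := inner_eq_chartMetric g (mem_chart_source E3 p) (show Tan p from v') w
  rw [fibreCoord_self (⟨p, v'⟩ : TM M), fibreCoord_self (⟨p, w⟩ : TM M)] at h
  have h1 : g.inner p (covFormula g p v u v') w =
      g.inner p (show Tan p from v') w + g.inner p (christoffel g p u v) w := by
    rw [covFormula, map_add]
    rfl
  rw [h1]
  exact congrArg₂ (· + ·) h (inner_christoffel g p u v w)

/-- The manifold derivative is by definition the derivative read in the chart induced at `Z t`. -/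
theorem hasDerivWithinAt_coord {Z : ℝ → TM M} {S : Set ℝ} {t : ℝ}
    {D : TangentSpace 𝓘(ℝ) t →L[ℝ] TangentSpace (𝓡 3).tangent (Z t)}
    (hZ : HasMFDerivWithinAt 𝓘(ℝ) (𝓡 3).tangent Z S t D) :
    HasDerivWithinAt (fun r => extChartAt (𝓡 3) (Z t).1 (Z r).1)
        (show E3 × E3 from D (1 : ℝ)).1 S t ∧
      HasDerivWithinAt (fun r => fibreCoord (Z t).1 (Z r)) (show E3 × E3 from D (1 : ℝ)).2 S t := by
  have h := hZ.2
  have hS : (extChartAt 𝓘(ℝ) t).symm ⁻¹' S ∩ range 𝓘(ℝ) = S := by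
    rw [extChartAt_model_space_eq_id]
    simp
  rw [hS] at h
  have h1 : HasDerivWithinAt
      (fun r => (extChartAt (𝓡 3) (Z t).1 (Z r).1, fibreCoord (Z t).1 (Z r)))
      (show E3 × E3 from D (1 : ℝ)) S t := by
    have h2 : HasFDerivWithinAt
      (fun r => (extChartAt (𝓡 3) (Z t).1 (Z r).1, fibreCoord (Z t).1 (Z r)))
      (show ℝ →L[ℝ] E3 × E3 from D) S t := h
    exact h2.hasDerivWithinAt
  exact ⟨h1.fst, h1.snd⟩

/-- The connector uses the chart centred at the current base point, which moves with `t`. Covariance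
of `coordCov` gives its expression in a fixed chart `p₀`. -/
theorem inner_connector (g : Metric3 M) {Z : ℝ → TM M} {S : Set ℝ} {t : ℝ} {p₀ : M}
    (hp₀ : (Z t).1 ∈ (chartAt E3 p₀).source)
    {D : TangentSpace 𝓘(ℝ) t →L[ℝ] TangentSpace (𝓡 3).tangent (Z t)}
    (hZ : HasMFDerivWithinAt 𝓘(ℝ) (𝓡 3).tangent Z S t D) :
    ∃ u v' : E3, HasDerivWithinAt (fun r => extChartAt (𝓡 3) p₀ (Z r).1) u S t ∧
      HasDerivWithinAt (fun r => fibreCoord p₀ (Z r)) v' S t ∧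
      ∀ w : Tan (Z t).1, g.inner (Z t).1 (connector g (Z t) (D (1 : ℝ))) w =
        coordCov (chartMetric g p₀) (extChartAt (𝓡 3) p₀ (Z t).1) u (fibreCoord p₀ (Z t)) v'
          (fibreCoord p₀ (⟨(Z t).1, w⟩ : TM M)) := by
  obtain ⟨hy, hv⟩ := hasDerivWithinAt_coord hZ
  set p := (Z t).1 with hp
  have hpp : p ∈ (chartAt E3 p).source := mem_chart_source E3 p
  have hproj : ContinuousWithinAt (fun r => (Z r).1) S t :=
    (FiberBundle.continuous_proj E3
      (fun p : M => TangentSpace (𝓡 3) p)).continuousAt.comp_continuousWithinAt hZ.1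
  have hev1 : ∀ᶠ r in 𝓝[S] t, (Z r).1 ∈ (chartAt E3 p).source :=
    hproj.preimage_mem_nhdsWithin ((chartAt E3 p).open_source.mem_nhds hpp)
  have hev2 : ∀ᶠ r in 𝓝[S] t, (Z r).1 ∈ (chartAt E3 p₀).source :=
    hproj.preimage_mem_nhdsWithin ((chartAt E3 p₀).open_source.mem_nhds hp₀)
  have hσ : ContDiffAt ℝ 2 (chartTransition p p₀) (extChartAt (𝓡 3) p p) :=
    (contDiffAt_chartTransition hpp hp₀).of_le ENat.LEInfty.out
  have hσ1 := (hσ.differentiableAt two_ne_zero).hasFDerivAt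
  have hσ2 := ((hσ.fderiv_right (m := 1) le_rfl).differentiableAt one_ne_zero).hasFDerivAt
  have hdσ : HasDerivWithinAt
      (fun r => fderiv ℝ (chartTransition p p₀) (extChartAt (𝓡 3) p (Z r).1)) _ S t :=
    HasFDerivAt.comp_hasDerivWithinAt (l := fderiv ℝ (chartTransition p p₀)) t hσ2 hy
  have hy₀ : HasDerivWithinAt
      (fun r => chartTransition p p₀ (extChartAt (𝓡 3) p (Z r).1)) _ S t :=
    HasFDerivAt.comp_hasDerivWithinAt (l := chartTransition p p₀) t hσ1 hy
  have hfc {r : ℝ} (h1 : (Z r).1 ∈ (chartAt E3 p).source)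
      (h2 : (Z r).1 ∈ (chartAt E3 p₀).source) (v : Tan (Z r).1) :
      fibreCoord p₀ (⟨(Z r).1, v⟩ : TM M) =
        fderiv ℝ (chartTransition p p₀) (extChartAt (𝓡 3) p (Z r).1)
          (fibreCoord p (⟨(Z r).1, v⟩ : TM M)) := by
    rw [fderiv_chartTransition, fibreCoord_transition h1 h2]
  -- The product rule for `Dσ` applied to the fibre coordinates supplies `v'`, including the
  -- second-derivative term required by `coordCov_pullback`.
  refine ⟨_, _, hy₀.congr_of_eventuallyEq (hev1.mono fun r hr => (chartTransition_apply hr).symm)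
    (chartTransition_apply hpp).symm, (hdσ.clm_apply hv).congr_of_eventuallyEq
    ((hev1.and hev2).mono fun r hr => hfc hr.1 hr.2 (Z r).2) (hfc hpp hp₀ (Z t).2), fun w => ?_⟩
  have hH : DifferentiableAt ℝ (chartMetric g p₀) (chartTransition p p₀ (extChartAt (𝓡 3) p p)) := by
    rw [chartTransition_apply hpp]
    exact (contDiffAt_chartMetric g hp₀).differentiableAt (by simp)
  have h := coordCov_pullback ((contDiffAt_chartMetric g hpp).differentiableAt (by simp)) hH hσ
    (fun v w => chartMetric_symm g p₀ _ v w) (eventually_chartMetric_transition g hpp hp₀)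
    (show E3 × E3 from D (1 : ℝ)).1 (Z t).2 (show E3 × E3 from D (1 : ℝ)).2 w
  rw [chartTransition_apply hpp] at h
  have hw := hfc (r := t) hpp hp₀ w
  have hZt := hfc (r := t) hpp hp₀ (Z t).2
  rw [fibreCoord_self (⟨(Z t).1, w⟩ : TM M)] at hw
  rw [fibreCoord_self (⟨(Z t).1, (Z t).2⟩ : TM M)] at hZt
  rw [connector, inner_covFormula, h, hw, fibreCoord_self (Z t)]
  congr 1
  exact hZt.symm

/-! ### Vector fields along a curve -/

theorem hasDerivWithinAt_inner (g : Metric3 M) {x : ℝ → M} {a b t : ℝ} (hab : a < b)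
    (ht : t ∈ Icc a b) {ν η : ∀ t, Tan (x t)}
    (hν : MDifferentiableWithinAt 𝓘(ℝ) (𝓡 3).tangent (fun r => (⟨x r, ν r⟩ : TM M)) (Icc a b) t)
    (hη : MDifferentiableWithinAt 𝓘(ℝ) (𝓡 3).tangent (fun r => (⟨x r, η r⟩ : TM M)) (Icc a b) t) :
    HasDerivWithinAt (fun r => g.inner (x r) (ν r) (η r))
      (g.inner (x t) (covDeriv g x a b ν t) (η t) + g.inner (x t) (covDeriv g x a b η t) (ν t))
      (Icc a b) t := by
  have hmem : x t ∈ (chartAt E3 (x t)).source := mem_chart_source E3 (x t)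
  obtain ⟨u, v', hu, hv, h1⟩ := inner_connector g hmem hν.hasMFDerivWithinAt
  obtain ⟨u', w', hu', hw, h2⟩ := inner_connector g hmem hη.hasMFDerivWithinAt
  -- Both fields lie over the same curve, so their base velocities agree by uniqueness of
  -- derivatives on the interval.
  obtain rfl : u' = u := (uniqueDiffOn_Icc hab t ht).eq_deriv _ hu' hu
  have h := hasDerivWithinAt_metric_apply (G := chartMetric g (x t))
    ((contDiffAt_chartMetric g hmem).differentiableAt (by simp))
    (Eventually.of_forall fun z v w => chartMetric_symm g (x t) z v w) hu hv hw
  have hx : ContinuousWithinAt x (Icc a b) t :=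
    (FiberBundle.continuous_proj E3
      (fun p : M => TangentSpace (𝓡 3) p)).continuousAt.comp_continuousWithinAt hν.1
  have hev : ∀ᶠ r in 𝓝[Icc a b] t, x r ∈ (chartAt E3 (x t)).source :=
    hx.preimage_mem_nhdsWithin ((chartAt E3 (x t)).open_source.mem_nhds hmem)
  refine (h.congr_of_eventuallyEq (hev.mono fun r hr => inner_eq_chartMetric g hr (ν r) (η r))
    (inner_eq_chartMetric g hmem (ν t) (η t))).congr_deriv ?_
  exact (congrArg₂ (· + ·) (h1 (η t)) (h2 (ν t))).symm

/-- Near `t₀` the single chart at `x t₀` serves for all nearby times. Continuity of the rotation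
rate, hence integrability of the Kropina integrand, comes from here. -/
theorem continuousOn_inner_covDeriv (g : Metric3 M) {x : ℝ → M} {a b : ℝ} (hab : a < b)
    {ν η : ∀ t, Tan (x t)}
    (hν : ContMDiffOn 𝓘(ℝ) (𝓡 3).tangent 1 (fun r => (⟨x r, ν r⟩ : TM M)) (Icc a b))
    (hη : ContMDiffOn 𝓘(ℝ) (𝓡 3).tangent 1 (fun r => (⟨x r, η r⟩ : TM M)) (Icc a b)) :
    ContinuousOn (fun t => g.inner (x t) (covDeriv g x a b ν t) (η t)) (Icc a b) := by
  intro t₀ ht₀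
  have hmem : x t₀ ∈ (chartAt E3 (x t₀)).source := mem_chart_source E3 (x t₀)
  obtain ⟨hx, hv⟩ := Bundle.contMDiffWithinAt_totalSpace.1 (hν t₀ ht₀)
  have hw := (Bundle.contMDiffWithinAt_totalSpace.1 (hη t₀ ht₀)).2
  have hy : ContDiffWithinAt ℝ 1 (fun r => extChartAt (𝓡 3) (x t₀) (x r)) (Icc a b) t₀ :=
    ((contMDiffAt_extChartAt (I := 𝓡 3) (n := 1) (x := x t₀)).comp_contMDiffWithinAt t₀
      hx).contDiffWithinAt
  have hv : ContDiffWithinAt ℝ 1 (fun r => fibreCoord (x t₀) (⟨x r, ν r⟩ : TM M)) (Icc a b) t₀ :=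
    hv.contDiffWithinAt
  have hw : ContDiffWithinAt ℝ 1 (fun r => fibreCoord (x t₀) (⟨x r, η r⟩ : TM M)) (Icc a b) t₀ :=
    hw.contDiffWithinAt
  have hdy := ((hy.fderivWithin_right (m := 0) (uniqueDiffOn_Icc hab) le_rfl
    ht₀).continuousWithinAt.clm_apply (continuousWithinAt_const (b := (1 : ℝ))))
  have hdv := ((hv.fderivWithin_right (m := 0) (uniqueDiffOn_Icc hab) le_rfl
    ht₀).continuousWithinAt.clm_apply (continuousWithinAt_const (b := (1 : ℝ))))
  have hc := continuousWithinAt_coordCov (G := chartMetric g (x t₀))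
    ((contDiffAt_chartMetric g hmem).of_le ENat.LEInfty.out) hy.continuousWithinAt hdy
    hv.continuousWithinAt hdv hw.continuousWithinAt
  have hval : ∀ t ∈ Icc a b, x t ∈ (chartAt E3 (x t₀)).source →
      g.inner (x t) (covDeriv g x a b ν t) (η t) =
        coordCov (chartMetric g (x t₀)) (extChartAt (𝓡 3) (x t₀) (x t))
          (fderivWithin ℝ (fun r => extChartAt (𝓡 3) (x t₀) (x r)) (Icc a b) t 1)
          (fibreCoord (x t₀) (⟨x t, ν t⟩ : TM M))
          (fderivWithin ℝ (fun r => fibreCoord (x t₀) (⟨x r, ν r⟩ : TM M)) (Icc a b) t 1)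
          (fibreCoord (x t₀) (⟨x t, η t⟩ : TM M)) := by
    intro t ht hxt
    obtain ⟨u, v', hu, hv, h1⟩ := inner_connector g hxt
      ((hν t ht).mdifferentiableWithinAt one_ne_zero).hasMFDerivWithinAt
    have hud := uniqueDiffOn_Icc hab t ht
    have e1 := hu.derivWithin hud
    have e2 := hv.derivWithin hud
    rw [← fderivWithin_derivWithin] at e1 e2
    rw [e1, e2]
    exact h1 (η t)
  have hev : ∀ᶠ r in 𝓝[Icc a b] t₀, x r ∈ (chartAt E3 (x t₀)).source :=
    hx.continuousWithinAt.preimage_mem_nhdsWithin ((chartAt E3 (x t₀)).open_source.mem_nhds hmem)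
  refine hc.congr_of_eventuallyEq ?_ (hval t₀ ht₀ hmem)
  filter_upwards [hev, self_mem_nhdsWithin] with r hr hr' using hval r hr' hr

theorem contMDiffOn_inner (g : Metric3 M) {x : ℝ → M} {n : ℕ∞} {S : Set ℝ} {ν η : ∀ t, Tan (x t)}
    (hν : ContMDiffOn 𝓘(ℝ) (𝓡 3).tangent n (fun r => (⟨x r, ν r⟩ : TM M)) S)
    (hη : ContMDiffOn 𝓘(ℝ) (𝓡 3).tangent n (fun r => (⟨x r, η r⟩ : TM M)) S) :
    ContDiffOn ℝ n (fun t => g.inner (x t) (ν t) (η t)) S := by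
  rw [← contMDiffOn_iff_contDiffOn]
  intro t ht
  have hx := (Bundle.contMDiffWithinAt_totalSpace.1 (hν t ht)).1
  have h := ContMDiffWithinAt.clm_bundle_apply₂ (F₁ := E3) (F₂ := E3) (F₃ := ℝ)
    (E₃ := Bundle.Trivial M ℝ)
    ((g.contMDiff.of_le (m := n) (by exact_mod_cast le_top)).contMDiffAt.comp_contMDiffWithinAt t hx)
    (hν t ht) (hη t ht)
  simp only [Bundle.contMDiffWithinAt_totalSpace] at h
  exact h.2

theorem contMDiffOn_smul_field {x : ℝ → M} {n : ℕ∞} {S : Set ℝ} {ν : ∀ t, Tan (x t)} {f : ℝ → ℝ}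
    (hf : ContDiffOn ℝ n f S)
    (hν : ContMDiffOn 𝓘(ℝ) (𝓡 3).tangent n (fun r => (⟨x r, ν r⟩ : TM M)) S) :
    ContMDiffOn 𝓘(ℝ) (𝓡 3).tangent n (fun r => (⟨x r, f r • ν r⟩ : TM M)) S := by
  intro t ht
  obtain ⟨hx, hv⟩ := Bundle.contMDiffWithinAt_totalSpace.1 (hν t ht)
  refine Bundle.contMDiffWithinAt_totalSpace.2 ⟨hx, ?_⟩
  have hmem : x t ∈ (chartAt E3 (x t)).source := mem_chart_source E3 (x t)
  have hev : ∀ᶠ r in 𝓝[S] t, x r ∈ (chartAt E3 (x t)).source :=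
    hx.continuousWithinAt.preimage_mem_nhdsWithin ((chartAt E3 (x t)).open_source.mem_nhds hmem)
  have hlin {r : ℝ} (hr : x r ∈ (chartAt E3 (x t)).source) :
      fibreCoord (x t) (⟨x r, f r • ν r⟩ : TM M) = f r • fibreCoord (x t) (⟨x r, ν r⟩ : TM M) :=
    ((trivializationAt E3 (fun p : M => TangentSpace (𝓡 3) p) (x t)).linear ℝ hr).map_smul (f r) (ν r)
  exact (((hf t ht).contMDiffWithinAt).smul hv).congr_of_eventuallyEq
    (hev.mono fun r hr => hlin hr) (hlin hmem)

theorem contMDiffOn_add_field {x : ℝ → M} {n : ℕ∞} {S : Set ℝ} {ν η : ∀ t, Tan (x t)}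
    (hν : ContMDiffOn 𝓘(ℝ) (𝓡 3).tangent n (fun r => (⟨x r, ν r⟩ : TM M)) S)
    (hη : ContMDiffOn 𝓘(ℝ) (𝓡 3).tangent n (fun r => (⟨x r, η r⟩ : TM M)) S) :
    ContMDiffOn 𝓘(ℝ) (𝓡 3).tangent n (fun r => (⟨x r, ν r + η r⟩ : TM M)) S := by
  intro t ht
  obtain ⟨hx, hv⟩ := Bundle.contMDiffWithinAt_totalSpace.1 (hν t ht)
  have hw := (Bundle.contMDiffWithinAt_totalSpace.1 (hη t ht)).2
  refine Bundle.contMDiffWithinAt_totalSpace.2 ⟨hx, ?_⟩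
  have hmem : x t ∈ (chartAt E3 (x t)).source := mem_chart_source E3 (x t)
  have hev : ∀ᶠ r in 𝓝[S] t, x r ∈ (chartAt E3 (x t)).source :=
    hx.continuousWithinAt.preimage_mem_nhdsWithin ((chartAt E3 (x t)).open_source.mem_nhds hmem)
  have hlin {r : ℝ} (hr : x r ∈ (chartAt E3 (x t)).source) :
      fibreCoord (x t) (⟨x r, ν r + η r⟩ : TM M) =
        fibreCoord (x t) (⟨x r, ν r⟩ : TM M) + fibreCoord (x t) (⟨x r, η r⟩ : TM M) :=
    ((trivializationAt E3 (fun p : M => TangentSpace (𝓡 3) p) (x t)).linear ℝ hr).map_add (ν r) (η r)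
  exact (hv.add hw).congr_of_eventuallyEq (hev.mono fun r hr => hlin hr) (hlin hmem)

/-! ### The unit tangent field -/

/-- The velocity is the tangent map of `x` composed with the constant unit field on the line. -/
theorem IsRegularCurve.contMDiffOn_velocity {x : ℝ → M} {a b : ℝ} (hx : IsRegularCurve x a b) :
    ContMDiffOn 𝓘(ℝ) (𝓡 3).tangent ∞ (fun t => (⟨x t, velocity x a b t⟩ : TM M)) (Icc a b) := by
  have h1 := hx.smooth.contMDiffOn_tangentMapWithin (m := ∞) (by simp)
    (uniqueDiffOn_Icc hx.lt).uniqueMDiffOn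
  have h2 : ContMDiff 𝓘(ℝ) 𝓘(ℝ).tangent ∞
      (fun t : ℝ => (⟨t, (1 : ℝ)⟩ : TangentBundle 𝓘(ℝ) ℝ)) := by
    intro t
    rw [contMDiffAt_vectorSpace_iff_contDiffAt (V := fun _ => (1 : ℝ))]
    exact contDiffAt_const
  exact h1.comp h2.contMDiffOn (fun t ht => ht)

theorem length_pos (g : Metric3 M) {p : M} {v : Tan p} (hv : v ≠ 0) : 0 < length g p v :=
  Real.sqrt_pos.2 (g.pos p v hv)

theorem length_sq (g : Metric3 M) {p : M} {v : Tan p} (hv : v ≠ 0) :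
    length g p v * length g p v = g.inner p v v :=
  Real.mul_self_sqrt (g.pos p v hv).le

theorem IsRegularCurve.contMDiffOn_lift (g : Metric3 M) {x : ℝ → M} {a b : ℝ}
    (hx : IsRegularCurve x a b) :
    ContMDiffOn 𝓘(ℝ) (𝓡 3).tangent ∞ (lift g x a b) (Icc a b) := by
  refine contMDiffOn_smul_field (n := ⊤) (f := fun t => (length g (x t) (velocity x a b t))⁻¹) ?_
    hx.contMDiffOn_velocity
  have h := contMDiffOn_inner g (n := ⊤) hx.contMDiffOn_velocity hx.contMDiffOn_velocity
  refine (h.sqrt fun t ht => (g.pos _ _ (hx.velocity_ne_zero t ht)).ne').inv fun t ht => ?_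
  exact (length_pos g (hx.velocity_ne_zero t ht)).ne'

theorem IsRegularCurve.velocity_eq (g : Metric3 M) {x : ℝ → M} {a b : ℝ}
    (hx : IsRegularCurve x a b) {t : ℝ} (ht : t ∈ Icc a b) :
    velocity x a b t = length g (x t) (velocity x a b t) • unitTangent g x a b t := by
  rw [unitTangent, smul_smul, mul_inv_cancel₀ (length_pos g (hx.velocity_ne_zero t ht)).ne',
    one_smul]

theorem IsRegularCurve.lift_mem (g : Metric3 M) {x : ℝ → M} {a b : ℝ}
    (hx : IsRegularCurve x a b) {t : ℝ} (ht : t ∈ Icc a b) :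
    lift g x a b t ∈ unitSphereBundle g := by
  have h0 := (length_pos g (hx.velocity_ne_zero t ht)).ne'
  change g.inner (x t) (unitTangent g x a b t) (unitTangent g x a b t) = 1
  rw [unitTangent, map_smul, map_smul, smul_apply, smul_eq_mul, smul_eq_mul,
    ← length_sq g (hx.velocity_ne_zero t ht)]
  field_simp

/-! ### Triples of tangent vectors -/

/-- The projections of `E3 × E3 × E3` to its factors. -/
def slot : Fin 3 → (E3 × E3 × E3 →L[ℝ] E3) :=
  ![.fst ℝ E3 (E3 × E3), .comp (.fst ℝ E3 E3) (.snd ℝ E3 (E3 × E3)),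
    .comp (.snd ℝ E3 E3) (.snd ℝ E3 (E3 × E3))]

/-- The fibre coordinates of a triple in the chart at `p`. -/
def tripleCoord (p : M) (u : Triples M) : E3 × E3 × E3 :=
  (trivializationAt (E3 × E3 × E3) (fun p : M =>
    TangentSpace (𝓡 3) p × TangentSpace (𝓡 3) p × TangentSpace (𝓡 3) p) p u).2

/-- The `j`-th vector of a triple. -/
def tripleVec (j : Fin 3) (u : Triples M) : TM M := ⟨u.proj, vec u.snd j⟩

/-- The trivialization of the Whitney sum acts factor by factor, so facts about triples reduce to
facts about `TM`. -/
theorem slot_tripleCoord (j : Fin 3) (p : M) (u : Triples M) :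
    slot j (tripleCoord p u) = fibreCoord p (tripleVec j u) := by
  fin_cases j <;> rfl

theorem slot_ext {v w : E3 × E3 × E3} (h : ∀ j, slot j v = slot j w) : v = w :=
  Prod.ext (h 0) (Prod.ext (h 1) (h 2))

theorem tripleCoord_self (u : Triples M) : tripleCoord u.proj u = u.snd := by
  refine slot_ext fun j => ?_
  rw [slot_tripleCoord]
  refine (fibreCoord_self (tripleVec j u)).trans ?_
  fin_cases j <;> rfl

theorem contMDiff_tripleVec (j : Fin 3) :
    ContMDiff modelTriples (𝓡 3).tangent ∞ (tripleVec (M := M) j) := by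
  intro u
  obtain ⟨h1, h2⟩ := Bundle.contMDiffAt_totalSpace.1
    (contMDiffAt_id (I := modelTriples) (n := ∞) (x := u))
  refine Bundle.contMDiffAt_totalSpace.2 ⟨h1, ?_⟩
  have h3 : ContMDiffAt modelTriples 𝓘(ℝ, E3) ∞ (fun u' => slot j (tripleCoord u.proj u')) u :=
    (slot j).contMDiff.contMDiffAt.comp u h2
  simp only [slot_tripleCoord] at h3
  exact h3

theorem hasDerivWithinAt_tripleCoord {c : ℝ → Triples M} {S : Set ℝ} {t : ℝ}
    {D : TangentSpace 𝓘(ℝ) t →L[ℝ] TangentSpace modelTriples (c t)}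
    (hc : HasMFDerivWithinAt 𝓘(ℝ) modelTriples c S t D) :
    HasDerivWithinAt (fun r => (extChartAt (𝓡 3) (c t).1 (c r).1, tripleCoord (c t).1 (c r)))
      (show E3 × E3 × E3 × E3 from D (1 : ℝ)) S t := by
  have h := hc.2
  have hS : (extChartAt 𝓘(ℝ) t).symm ⁻¹' S ∩ range 𝓘(ℝ) = S := by
    rw [extChartAt_model_space_eq_id]
    simp
  rw [hS] at h
  have h2 : HasFDerivWithinAt
      (fun r => (extChartAt (𝓡 3) (c t).1 (c r).1, tripleCoord (c t).1 (c r)))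
      (show ℝ →L[ℝ] E3 × E3 × E3 × E3 from D) S t := h
  exact h2.hasDerivWithinAt

/-- This links the connection form, evaluated on a velocity in the bundle of triples, to covariant
derivatives of the single vectors, computed from curves in `TM`. -/
theorem mfderivWithin_tripleVec {c : ℝ → Triples M} {S : Set ℝ} {t : ℝ}
    (hS : UniqueDiffWithinAt ℝ S t)
    {D : TangentSpace 𝓘(ℝ) t →L[ℝ] TangentSpace modelTriples (c t)}
    (hc : HasMFDerivWithinAt 𝓘(ℝ) modelTriples c S t D) (j : Fin 3) :
    (show E3 × E3 from
        mfderivWithin 𝓘(ℝ) (𝓡 3).tangent (fun r => tripleVec j (c r)) S t (1 : ℝ)) =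
      ((show E3 from baseVel (D (1 : ℝ))), fiberVel (D (1 : ℝ)) j) := by
  have hd := (((contMDiff_tripleVec (M := M) j).mdifferentiable (by simp)
    (c t)).comp_mdifferentiableWithinAt t hc.mdifferentiableWithinAt).hasMFDerivWithinAt
  obtain ⟨h1, h2⟩ := hasDerivWithinAt_coord hd
  have h := hasDerivWithinAt_tripleCoord hc
  refine Prod.ext (hS.eq_deriv _ h1 h.fst) ?_
  have h3 : HasDerivWithinAt (fun r => slot j (tripleCoord (c t).1 (c r)))
      (slot j (show E3 × E3 × E3 × E3 from D (1 : ℝ)).2) S t :=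
    HasFDerivAt.comp_hasDerivWithinAt (l := slot j) t (slot j).hasFDerivAt h.snd
  simp only [slot_tripleCoord] at h3
  refine (hS.eq_deriv _ h2 h3).trans ?_
  fin_cases j <;> rfl

/-! ### The generator of the circle action -/

/-- All tangent spaces are the same model space, so the transport along an equality of points in the
definition of `generator` does not change coordinates. -/
theorem cast_tangentSpace {u u' : Triples M} (h : u' = u) (V : TangentSpace modelTriples u') :
    (show E3 × E3 × E3 × E3 from (h ▸ V : TangentSpace modelTriples u)) =
      (show E3 × E3 × E3 × E3 from V) := by
  subst h
  rfl

/-- The rotation of the first two vectors of a triple in a normed space. -/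
def rotateTriple (v : E3 × E3 × E3) (r : ℝ) : E3 × E3 × E3 :=
  (Real.cos r • v.1 - Real.sin r • v.2.1, Real.sin r • v.1 + Real.cos r • v.2.1, v.2.2)

theorem contDiff_rotateTriple (v : E3 × E3 × E3) : ContDiff ℝ 1 (rotateTriple v) := by
  have hc (v : E3) : ContDiff ℝ 1 (fun r => Real.cos r • v) :=
    Real.contDiff_cos.smul contDiff_const
  have hs (v : E3) : ContDiff ℝ 1 (fun r => Real.sin r • v) :=
    Real.contDiff_sin.smul contDiff_const
  exact ((hc v.1).sub (hs v.2.1)).prodMk (((hs v.1).add (hc v.2.1)).prodMk contDiff_const)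

theorem hasDerivAt_rotateTriple (v : E3 × E3 × E3) :
    HasDerivAt (rotateTriple v) (-v.2.1, v.1, 0) 0 := by
  have hc (v : E3) : HasDerivAt (fun r => Real.cos r • v) (0 : E3) 0 := by
    simpa using (Real.hasDerivAt_cos 0).smul_const v
  have hs (v : E3) : HasDerivAt (fun r => Real.sin r • v) v 0 := by
    simpa using (Real.hasDerivAt_sin 0).smul_const v
  have h1 : HasDerivAt (fun r => Real.cos r • v.1 - Real.sin r • v.2.1) (-v.2.1) 0 := by
    simpa using (hc v.1).fun_sub (hs v.2.1)
  have h2 : HasDerivAt (fun r => Real.sin r • v.1 + Real.cos r • v.2.1) v.1 0 := by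
    simpa using (hs v.1).fun_add (hc v.2.1)
  exact h1.prodMk (h2.prodMk (hasDerivAt_const 0 v.2.2))

theorem tripleCoord_rotateFrame (u : Triples M) (r : ℝ) :
    tripleCoord u.proj (rotateFrame u r) = rotateTriple u.snd r :=
  tripleCoord_self (rotateFrame u r)

theorem mdifferentiableAt_rotateFrame (u : Triples M) :
    MDifferentiableAt 𝓘(ℝ) modelTriples (rotateFrame u) 0 := by
  refine ContMDiffAt.mdifferentiableAt (n := 1) ?_ one_ne_zero
  refine Bundle.contMDiffAt_totalSpace.2 ⟨contMDiffAt_const, ?_⟩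
  exact ((contDiff_rotateTriple u.snd).contDiffAt.congr_of_eventuallyEq
    (Eventually.of_forall (tripleCoord_rotateFrame u))).contMDiffAt

theorem generator_eq (u : Triples M) :
    (show E3 × E3 × E3 × E3 from generator u) =
      (0, (show E3 from -u.snd.2.1), (show E3 from u.snd.1), 0) := by
  refine (cast_tangentSpace (rotateFrame_zero u) _).trans ?_
  have h := hasDerivWithinAt_tripleCoord
    (mdifferentiableAt_rotateFrame u).hasMFDerivAt.hasMFDerivWithinAt (S := univ)
  have h1 : HasDerivAt (fun r => (extChartAt (𝓡 3) u.proj u.proj, rotateTriple u.snd r))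
      (0, -(show E3 × E3 × E3 from u.snd).2.1, (show E3 × E3 × E3 from u.snd).1, 0) 0 :=
    (hasDerivAt_const _ _).prodMk (hasDerivAt_rotateTriple u.snd)
  refine uniqueDiffWithinAt_univ.eq_deriv _ h (h1.hasDerivWithinAt.congr_of_eventuallyEq
    (Eventually.of_forall fun r => ?_) ?_)
  · exact congrArg (Prod.mk _) (tripleCoord_rotateFrame u r)
  · exact congrArg (Prod.mk _) (tripleCoord_rotateFrame u 0)

/-! ### The Fefferman metric on orthonormal frames -/

/-- The Christoffel term is linear in the base velocity, so on vertical vectors only the fibre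
derivative remains. -/
theorem inner_covFormula_zero (g : Metric3 M) (p : M) (v : Tan p) (v' : E3) (w : Tan p) :
    g.inner p w (covFormula g p v 0 v') = g.inner p w (show Tan p from v') := by
  have h : g.inner p w (covFormula g p v 0 v') =
      g.inner p w (show Tan p from v') + g.inner p w (christoffel g p (0 : E3) v) := by
    rw [covFormula, map_add]
  have h0 := inner_christoffel g p (0 : E3) v w
  have hL (L : E3 →L[ℝ] E3 →L[ℝ] E3 →L[ℝ] ℝ) (v w : E3) :
      (L 0 v w + L v 0 w - L w 0 v) / 2 = 0 := by simp
  rw [h, g.symm p w (christoffel g p (0 : E3) v)]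
  rw [h0.trans (hL (chartMetricDeriv g p) v w), add_zero]

theorem canonicalForm_generator (g : Metric3 M) (u : Triples M) (i : Fin 3) :
    canonicalForm g u (generator u) i = 0 := by
  have h : baseVel (generator u) = (0 : E3) := congrArg Prod.fst (generator_eq u)
  rw [canonicalForm, h]
  exact map_zero _

/-- Along `K` the frame satisfies `∇e_1 = -e_2`, `∇e_2 = e_1`, `∇e_3 = 0`; orthonormality does the
rest. -/
theorem connectionForm_generator (g : Metric3 M) {u : Triples M}
    (hu : ∀ i j, g.inner u.proj (vec u.snd i) (vec u.snd j) = if i = j then 1 else 0) :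
    connectionForm g u (generator u) = ![0, 0, 1] := by
  have h : baseVel (generator u) = (0 : E3) := congrArg Prod.fst (generator_eq u)
  have hf : fiberVel (generator u) =
      ![(show E3 from -u.snd.2.1), (show E3 from u.snd.1), 0] := by
    have h2 := congrArg Prod.snd (generator_eq u)
    funext j
    fin_cases j
    · exact congrArg Prod.fst h2
    · exact congrArg (fun z => z.2.1) h2
    · exact congrArg (fun z => z.2.2) h2
  have hM (i j : Fin 3) : connectionMatrix g u (generator u) i j =
      g.inner u.proj (vec u.snd i) (show Tan u.proj from
        (![(show E3 from -u.snd.2.1), (show E3 from u.snd.1), 0] : Fin 3 → E3) j) := by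
    rw [connectionMatrix, Matrix.of_apply, h, hf, inner_covFormula_zero]
  have h12 : connectionMatrix g u (generator u) 1 2 = 0 :=
    (hM 1 2).trans (map_zero (g.inner u.proj (vec u.snd 1)))
  have h20 : connectionMatrix g u (generator u) 2 0 = 0 := by
    refine (hM 2 0).trans ((map_neg (g.inner u.proj (vec u.snd 2)) (vec u.snd 1)).trans ?_)
    rw [hu]
    simp
  have h01 : connectionMatrix g u (generator u) 0 1 = 1 := (hM 0 1).trans (hu 0 0)
  rw [connectionForm, h12, h20, h01]

/-- As `φ(K) = 0` and `ω(K) = (0, 0, 1)`, the only surviving term is `φ^3(V) ω^3(K)`, and the factor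
2 cancels the one half of the symmetric product. -/
theorem fefferman_generator (g : Metric3 M) {u : Triples M}
    (hu : ∀ i j, g.inner u.proj (vec u.snd i) (vec u.snd j) = if i = j then 1 else 0)
    (V : TangentSpace modelTriples u) :
    fefferman g u (generator u) V = canonicalForm g u V 2 := by
  simp [fefferman, canonicalForm_generator, connectionForm_generator g hu, Fin.sum_univ_three]
  ring

/-! ### Adapted frames along a curve -/

/-- A `C^1` orthonormal frame `e_1, e_2, e_3` along a curve, with `e_3` the unit tangent. -/
structure IsAdaptedFrame (g : Metric3 M) (x : ℝ → M) (a b : ℝ) (e : Fin 3 → ∀ t, Tan (x t)) :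
    Prop where
  orthonormal : ∀ t ∈ Icc a b, ∀ i j, g.inner (x t) (e i t) (e j t) = if i = j then 1 else 0
  third : ∀ t ∈ Icc a b, e 2 t = unitTangent g x a b t
  smooth : ∀ j, ContMDiffOn 𝓘(ℝ) (𝓡 3).tangent 1 (fun t => (⟨x t, e j t⟩ : TM M)) (Icc a b)

/-- The frame along a curve given by a section of `𝒫 → SM`. -/
def sectionFrame (g : Metric3 M) (x : ℝ → M) (a b : ℝ) (s : ∀ v : TM M, TripleFiber v.proj)
    (j : Fin 3) (t : ℝ) : Tan (x t) := vec (s (lift g x a b t)) j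

/-- The rate of rotation of the first two vectors of a frame, with respect to the normal
connection. -/
def rotationRate (g : Metric3 M) (x : ℝ → M) (a b : ℝ) (e : Fin 3 → ∀ t, Tan (x t)) (t : ℝ) : ℝ :=
  g.inner (x t) (covDeriv g x a b (e 1) t) (e 0 t)

/-! ### The section along the lift, and the value of the Kropina metric there. -/

section Section

variable {g : Metric3 M} {o : ManifoldOrientation M} {x : ℝ → M} {a b : ℝ} {U : Set (TM M)}
  {s : ∀ v : TM M, TripleFiber v.proj}

theorem contMDiffOn_section_lift (hx : IsRegularCurve x a b) (hs : IsLocalSection g o U s)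
    (hU : ∀ t ∈ Icc a b, lift g x a b t ∈ U) :
    ContMDiffOn 𝓘(ℝ) modelTriples ∞ (fun t => sectionMap s (lift g x a b t)) (Icc a b) :=
  hs.smooth.comp (hx.contMDiffOn_lift g) fun t ht => ⟨hU t ht, hx.lift_mem g ht⟩

theorem isAdaptedFrame_sectionFrame (hx : IsRegularCurve x a b) (hs : IsLocalSection g o U s)
    (hU : ∀ t ∈ Icc a b, lift g x a b t ∈ U) :
    IsAdaptedFrame g x a b (sectionFrame g x a b s) where
  orthonormal t ht := (hs.mem_frameBundle _ ⟨hU t ht, hx.lift_mem g ht⟩).1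
  third t ht := hs.third _ ⟨hU t ht, hx.lift_mem g ht⟩
  smooth j := ((contMDiff_tripleVec j).comp_contMDiffOn
    (contMDiffOn_section_lift hx hs hU)).of_le ENat.LEInfty.out

/-- A derivative within the hypersurface `SM` of `TM` is not determined in transverse directions.
The chain rule accepts any choice because the lift stays in `U ∩ SM`, and its value on the velocity
of the lift is then forced. -/
theorem hasMFDerivWithinAt_section_lift (hx : IsRegularCurve x a b) (hs : IsLocalSection g o U s)
    (hU : ∀ t ∈ Icc a b, lift g x a b t ∈ U) {t : ℝ} (ht : t ∈ Icc a b) :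
    ∃ D : TangentSpace 𝓘(ℝ) t →L[ℝ] TangentSpace modelTriples (sectionMap s (lift g x a b t)),
      HasMFDerivWithinAt 𝓘(ℝ) modelTriples (fun t => sectionMap s (lift g x a b t)) (Icc a b) t D ∧
      D (1 : ℝ) = sectionPush g U s (lift g x a b t) (liftVelocity g x a b t) := by
  have h1 := ((hs.smooth _ ⟨hU t ht, hx.lift_mem g ht⟩).mdifferentiableWithinAt
    (by simp)).hasMFDerivWithinAt
  have h2 := ((hx.contMDiffOn_lift g t ht).mdifferentiableWithinAt (by simp)).hasMFDerivWithinAt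
  exact ⟨_, h1.comp t h2 fun r hr => ⟨hU r hr, hx.lift_mem g hr⟩, rfl⟩

theorem velocity_section_lift (hx : IsRegularCurve x a b) (hs : IsLocalSection g o U s)
    (hU : ∀ t ∈ Icc a b, lift g x a b t ∈ U) {t : ℝ} (ht : t ∈ Icc a b) (j : Fin 3) :
    baseVel (sectionPush g U s (lift g x a b t) (liftVelocity g x a b t)) = velocity x a b t ∧
    covDeriv g x a b (sectionFrame g x a b s j) t =
      covFormula g (x t) (sectionFrame g x a b s j t)
        (show E3 from baseVel (sectionPush g U s (lift g x a b t) (liftVelocity g x a b t)))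
        (fiberVel (sectionPush g U s (lift g x a b t) (liftVelocity g x a b t)) j) := by
  obtain ⟨D, hD, hD1⟩ := hasMFDerivWithinAt_section_lift hx hs hU ht
  have hud := uniqueDiffOn_Icc hx.lt t ht
  rw [← hD1]
  constructor
  · have h1 : HasDerivWithinAt (fun r => extChartAt (𝓡 3) (x t) (x r))
        (show E3 from baseVel (D (1 : ℝ))) (Icc a b) t := (hasDerivWithinAt_tripleCoord hD).fst
    have h2 := ((hx.smooth t ht).mdifferentiableWithinAt (by simp)).hasMFDerivWithinAt.2
    have hS : (extChartAt 𝓘(ℝ) t).symm ⁻¹' Icc a b ∩ range 𝓘(ℝ) = Icc a b := by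
      rw [extChartAt_model_space_eq_id]
      simp
    rw [hS] at h2
    have h3 : HasFDerivWithinAt (fun r => extChartAt (𝓡 3) (x t) (x r))
      (show ℝ →L[ℝ] E3 from mfderivWithin 𝓘(ℝ) (𝓡 3) x (Icc a b) t) (Icc a b) t := h2
    exact UniqueDiffWithinAt.eq_deriv (F := E3) _ hud h1 h3.hasDerivWithinAt
  · have h := mfderivWithin_tripleVec hud hD j
    exact congrArg (fun z : E3 × E3 => covFormula g (x t) (sectionFrame g x a b s j t) z.1 z.2) h

/-- The base velocity is `|ẋ| T`, and `T` is the third vector of the orthonormal frame. -/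
theorem canonicalForm_section (hx : IsRegularCurve x a b) (hs : IsLocalSection g o U s)
    (hU : ∀ t ∈ Icc a b, lift g x a b t ∈ U) {t : ℝ} (ht : t ∈ Icc a b) (i : Fin 3) :
    canonicalForm g (sectionMap s (lift g x a b t))
      (sectionPush g U s (lift g x a b t) (liftVelocity g x a b t)) i =
      if i = 2 then length g (x t) (velocity x a b t) else 0 := by
  have hf := isAdaptedFrame_sectionFrame hx hs hU
  have h : canonicalForm g (sectionMap s (lift g x a b t))
      (sectionPush g U s (lift g x a b t) (liftVelocity g x a b t)) i =
      g.inner (x t) (sectionFrame g x a b s i t) (velocity x a b t) :=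
    congrArg (g.inner (x t) (sectionFrame g x a b s i t))
      (velocity_section_lift hx hs hU ht i).1
  rw [h, congrArg (g.inner (x t) (sectionFrame g x a b s i t)) (hx.velocity_eq g ht), map_smul,
    ← hf.third t ht, hf.orthonormal t ht]
  simp

theorem kropinaDenom_section (hx : IsRegularCurve x a b) (hs : IsLocalSection g o U s)
    (hU : ∀ t ∈ Icc a b, lift g x a b t ∈ U) {t : ℝ} (ht : t ∈ Icc a b) :
    kropinaDenom g U s (lift g x a b t) (liftVelocity g x a b t) =
      length g (x t) (velocity x a b t) := by
  have hf := isAdaptedFrame_sectionFrame hx hs hU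
  rw [kropinaDenom, fefferman_generator g (hf.orthonormal t ht), canonicalForm_section hx hs hU ht]
  simp

/-- Only `φ^3 = |ẋ|` is nonzero, so the numerator is `2 |ẋ| ω^3`; dividing by `|ẋ|` leaves twice the
rotation rate. -/
theorem kropina_section (hx : IsRegularCurve x a b) (hs : IsLocalSection g o U s)
    (hU : ∀ t ∈ Icc a b, lift g x a b t ∈ U) {t : ℝ} (ht : t ∈ Icc a b) :
    kropina g U s (lift g x a b t) (liftVelocity g x a b t) =
      2 * rotationRate g x a b (sectionFrame g x a b s) t := by
  have h0 := (length_pos g (hx.velocity_ne_zero t ht)).ne'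
  have hω : connectionForm g (sectionMap s (lift g x a b t))
      (sectionPush g U s (lift g x a b t) (liftVelocity g x a b t)) 2 =
      rotationRate g x a b (sectionFrame g x a b s) t := by
    rw [rotationRate, g.symm]
    exact congrArg (g.inner (x t) (sectionFrame g x a b s 0 t))
      (velocity_section_lift hx hs hU ht 1).2.symm
  rw [kropina, kropinaDenom_section hx hs hU ht, fefferman, div_eq_iff h0]
  simp only [canonicalForm_section hx hs hU ht, Fin.sum_univ_three, hω]
  simp
  ring

end Section

/-! ### Parallel transport for the normal connection -/

theorem eq_sum_of_orthonormal (g : Metric3 M) {p : M} {v : Fin 3 → Tan p}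
    (hv : ∀ i j, g.inner p (v i) (v j) = if i = j then 1 else 0) (u : Tan p) :
    u = g.inner p (v 0) u • v 0 + g.inner p (v 1) u • v 1 + g.inner p (v 2) u • v 2 := by
  have hsum (c : Fin 3 → ℝ) (j : Fin 3) : g.inner p (v j) (∑ i, c i • v i) = c j := by
    rw [map_sum]
    simp [hv]
  have hli : LinearIndependent ℝ v := by
    rw [Fintype.linearIndependent_iff]
    intro c hc j
    rw [← hsum c j, hc, map_zero]
  have hcard : Fintype.card (Fin 3) = Module.finrank ℝ (Tan p) := by
    have h : Module.finrank ℝ E3 = 3 := by simp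
    exact (Fintype.card_fin 3).trans h.symm
  let B := basisOfLinearIndependentOfCardEqFinrank hli hcard
  have hB : ⇑B = v := coe_basisOfLinearIndependentOfCardEqFinrank hli hcard
  have hu := B.sum_repr u
  rw [hB] at hu
  have hc (j : Fin 3) : g.inner p (v j) u = B.repr u j := by
    conv_lhs => rw [← hu]
    exact hsum _ j
  rw [hc, hc, hc]
  conv_lhs => rw [← hu]
  rw [Fin.sum_univ_three]

namespace IsAdaptedFrame

variable {g : Metric3 M} {x : ℝ → M} {a b : ℝ} {e : Fin 3 → ∀ t, Tan (x t)}

/-- Differentiating the constants `g(e_i, e_j)` shows that the connection matrix is skew. -/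
theorem inner_covDeriv_add (hab : a < b) (he : IsAdaptedFrame g x a b e) {t : ℝ}
    (ht : t ∈ Icc a b) (i j : Fin 3) :
    g.inner (x t) (covDeriv g x a b (e i) t) (e j t)
      + g.inner (x t) (covDeriv g x a b (e j) t) (e i t) = 0 := by
  have h := hasDerivWithinAt_inner g hab ht ((he.smooth i t ht).mdifferentiableWithinAt one_ne_zero)
    ((he.smooth j t ht).mdifferentiableWithinAt one_ne_zero)
  exact (uniqueDiffOn_Icc hab t ht).eq_deriv _ h
    ((hasDerivWithinAt_const t (Icc a b) (if i = j then (1 : ℝ) else 0)).congr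
      (fun r hr => he.orthonormal r hr i j) (he.orthonormal t ht i j))

theorem continuousOn_rotationRate (hab : a < b) (he : IsAdaptedFrame g x a b e) :
    ContinuousOn (rotationRate g x a b e) (Icc a b) :=
  continuousOn_inner_covDeriv g hab (he.smooth 1) (he.smooth 0)

theorem mem_normalSpace_iff (hx : IsRegularCurve x a b) (he : IsAdaptedFrame g x a b e) {t : ℝ}
    (ht : t ∈ Icc a b) {v : Tan (x t)} :
    v ∈ normalSpace g x a b t ↔ g.inner (x t) (e 2 t) v = 0 := by
  have h0 := (length_pos g (hx.velocity_ne_zero t ht)).ne'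
  have h : g.inner (x t) (velocity x a b t) v =
      length g (x t) (velocity x a b t) * g.inner (x t) (e 2 t) v := by
    rw [g.symm, congrArg (g.inner (x t) v) (hx.velocity_eq g ht), map_smul, ← he.third t ht,
      g.symm (x t) v, smul_eq_mul]
  have h1 : v ∈ normalSpace g x a b t ↔ g.inner (x t) (velocity x a b t) v = 0 := LinearMap.mem_ker
  rw [h1, h, mul_eq_zero, or_iff_right h0]

theorem eq_of_mem_normalSpace (hx : IsRegularCurve x a b) (he : IsAdaptedFrame g x a b e) {t : ℝ}
    (ht : t ∈ Icc a b) {v : Tan (x t)} (hv : v ∈ normalSpace g x a b t) :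
    v = g.inner (x t) (e 0 t) v • e 0 t + g.inner (x t) (e 1 t) v • e 1 t := by
  have h := eq_sum_of_orthonormal g (he.orthonormal t ht) v
  rwa [(he.mem_normalSpace_iff hx ht).1 hv, zero_smul, add_zero] at h

/-- The components of a normal field satisfy a linear system, up to its covariant derivative. -/
theorem hasDerivWithinAt_components (hx : IsRegularCurve x a b) (he : IsAdaptedFrame g x a b e)
    {ν : ∀ t, Tan (x t)} {t : ℝ} (ht : t ∈ Icc a b)
    (hν : MDifferentiableWithinAt 𝓘(ℝ) (𝓡 3).tangent (fun r => (⟨x r, ν r⟩ : TM M)) (Icc a b) t)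
    (hn : ν t ∈ normalSpace g x a b t) :
    HasDerivWithinAt (fun r => g.inner (x r) (e 0 r) (ν r))
      (g.inner (x t) (e 0 t) (covDeriv g x a b ν t)
        - rotationRate g x a b e t * g.inner (x t) (e 1 t) (ν t)) (Icc a b) t ∧
    HasDerivWithinAt (fun r => g.inner (x r) (e 1 r) (ν r))
      (g.inner (x t) (e 1 t) (covDeriv g x a b ν t)
        + rotationRate g x a b e t * g.inner (x t) (e 0 t) (ν t)) (Icc a b) t := by
  have h (i : Fin 3) := hasDerivWithinAt_inner g hx.lt ht
    ((he.smooth i t ht).mdifferentiableWithinAt one_ne_zero) hν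
  have h00 := he.inner_covDeriv_add hx.lt ht 0 0
  have h01 := he.inner_covDeriv_add hx.lt ht 0 1
  have h11 := he.inner_covDeriv_add hx.lt ht 1 1
  -- Since `ν t` is normal, its expansion has no component along the tangent, and the derivative of
  -- the tangent never enters.
  have hexp (i : Fin 3) : g.inner (x t) (covDeriv g x a b (e i) t) (ν t) =
      g.inner (x t) (e 0 t) (ν t) * g.inner (x t) (covDeriv g x a b (e i) t) (e 0 t) +
      g.inner (x t) (e 1 t) (ν t) * g.inner (x t) (covDeriv g x a b (e i) t) (e 1 t) := by
    conv_lhs => rw [he.eq_of_mem_normalSpace hx ht hn]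
    rw [map_add, map_smul, map_smul, smul_eq_mul, smul_eq_mul]
  refine ⟨(h 0).congr_deriv ?_, (h 1).congr_deriv ?_⟩
  · rw [hexp, g.symm (x t) _ (e 0 t), rotationRate]
    rw [g.symm (x t) (covDeriv g x a b ν t)]
    linear_combination (g.inner (x t) (e 0 t) (ν t) / 2) * h00 + g.inner (x t) (e 1 t) (ν t) * h01
      + g.inner (x t) (e 0 t) (ν t) * (g.symm (x t) (e 0 t) (covDeriv g x a b (e 0) t))
  · rw [hexp, rotationRate, g.symm (x t) (covDeriv g x a b ν t)]
    linear_combination (g.inner (x t) (e 1 t) (ν t) / 2) * h11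

/-- A primitive of the rotation rate. -/
def rotationAngle (g : Metric3 M) (x : ℝ → M) (a b : ℝ) (hab : a ≤ b)
    (e : Fin 3 → ∀ t, Tan (x t)) (t : ℝ) : ℝ :=
  -- The constant extension of the integrand beyond `[a, b]` makes the primitive `C^1` on the whole
  -- line.
  ∫ r in a..t, IccExtend hab ((Icc a b).domRestrict (rotationRate g x a b e)) r

theorem hasDerivAt_rotationAngle (hab : a < b) (he : IsAdaptedFrame g x a b e) (t : ℝ) :
    HasDerivAt (rotationAngle g x a b hab.le e)
      (IccExtend hab.le ((Icc a b).domRestrict (rotationRate g x a b e)) t) t := by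
  have hc : Continuous (IccExtend hab.le ((Icc a b).domRestrict (rotationRate g x a b e))) :=
    (continuousOn_iff_continuous_domRestrict.1 (he.continuousOn_rotationRate hab)).Icc_extend'
  exact (hc.integral_hasStrictDerivAt a t).hasDerivAt

theorem contDiff_rotationAngle (hab : a < b) (he : IsAdaptedFrame g x a b e) :
    ContDiff ℝ 1 (rotationAngle g x a b hab.le e) := by
  have hc : Continuous (IccExtend hab.le ((Icc a b).domRestrict (rotationRate g x a b e))) :=
    (continuousOn_iff_continuous_domRestrict.1 (he.continuousOn_rotationRate hab)).Icc_extend'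
  refine contDiff_one_iff_deriv.2
    ⟨fun t => (he.hasDerivAt_rotationAngle hab t).differentiableAt, ?_⟩
  rwa [funext fun t => (he.hasDerivAt_rotationAngle hab t).deriv]

theorem hasDerivWithinAt_rotationAngle (hab : a < b) (he : IsAdaptedFrame g x a b e) {t : ℝ}
    (ht : t ∈ Icc a b) :
    HasDerivWithinAt (rotationAngle g x a b hab.le e) (rotationRate g x a b e t) (Icc a b) t := by
  have h := (he.hasDerivAt_rotationAngle hab t).hasDerivWithinAt (s := Icc a b)
  rwa [IccExtend_of_mem hab.le _ ht] at h

theorem rotationAngle_left (hab : a ≤ b) : rotationAngle g x a b hab e a = 0 :=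
  intervalIntegral.integral_same

theorem rotationAngle_right (hab : a ≤ b) :
    rotationAngle g x a b hab e b = ∫ t in a..b, rotationRate g x a b e t := by
  refine intervalIntegral.integral_congr fun t ht => ?_
  rw [uIcc_of_le hab] at ht
  exact IccExtend_of_mem hab _ ht

/-- Normal parallel fields rotate with respect to the frame. -/
theorem parallel_right (hx : IsRegularCurve x a b) (he : IsAdaptedFrame g x a b e)
    {ν : ∀ t, Tan (x t)} (hν : IsNormalParallel g x a b ν) :
    ν b = (Real.cos (rotationAngle g x a b hx.lt.le e b) * g.inner (x a) (e 0 a) (ν a)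
        - Real.sin (rotationAngle g x a b hx.lt.le e b) * g.inner (x a) (e 1 a) (ν a)) • e 0 b
      + (Real.sin (rotationAngle g x a b hx.lt.le e b) * g.inner (x a) (e 0 a) (ν a)
        + Real.cos (rotationAngle g x a b hx.lt.le e b) * g.inner (x a) (e 1 a) (ν a)) • e 1 b := by
  have ha : a ∈ Icc a b := left_mem_Icc.2 hx.lt.le
  have hb : b ∈ Icc a b := right_mem_Icc.2 hx.lt.le
  -- A parallel normal field has covariant derivative proportional to `T`, hence orthogonal to the
  -- first two frame vectors.
  have hd : ∀ t ∈ Icc a b, ∀ i : Fin 3, i ≠ 2 →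
      g.inner (x t) (e i t) (covDeriv g x a b ν t) = 0 := by
    intro t ht i hi
    have h := hν.parallel t ht
    rw [normalCovDeriv, sub_eq_zero] at h
    rw [h, map_smul, ← he.third t ht, he.orthonormal t ht, if_neg hi, smul_zero]
  set A : ℝ → ℝ := fun r => g.inner (x r) (e 0 r) (ν r) with hA
  set B : ℝ → ℝ := fun r => g.inner (x r) (e 1 r) (ν r) with hB
  set Θ : ℝ → ℝ := rotationAngle g x a b hx.lt.le e with hΘ
  have hAB : ∀ t ∈ Icc a b,
      HasDerivWithinAt A (-(rotationRate g x a b e t * B t)) (Icc a b) t ∧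
      HasDerivWithinAt B (rotationRate g x a b e t * A t) (Icc a b) t := by
    intro t ht
    have h := he.hasDerivWithinAt_components hx ht
      ((hν.contMDiff t ht).mdifferentiableWithinAt one_ne_zero) (hν.normal t ht)
    rwa [hd t ht 0 (by decide), hd t ht 1 (by decide), zero_sub, zero_add] at h
  have hconst {f : ℝ → ℝ} (hf : ∀ t ∈ Icc a b, HasDerivWithinAt f 0 (Icc a b) t) : f b = f a := by
    have h := (convex_Icc a b).norm_image_sub_le_of_norm_hasDerivWithin_le (C := 0) hf
      (fun t _ => by simp) ha hb
    rw [zero_mul, norm_le_zero_iff, sub_eq_zero] at h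
    exact h
  have hΘd : ∀ t ∈ Icc a b, HasDerivWithinAt Θ (rotationRate g x a b e t) (Icc a b) t :=
    fun t ht => he.hasDerivWithinAt_rotationAngle hx.lt ht
  have hΘa : Θ a = 0 := rotationAngle_left hx.lt.le
  -- In the frame turned by `Θ`, the components of a parallel field are constant; these are the two
  -- components.
  have h1 := hconst (f := fun t => A t * Real.cos (Θ t) + B t * Real.sin (Θ t)) fun t ht => by
    refine (((hAB t ht).1.mul (hΘd t ht).cos).add
      ((hAB t ht).2.mul (hΘd t ht).sin)).congr_deriv ?_
    ring
  have h2 := hconst (f := fun t => B t * Real.cos (Θ t) - A t * Real.sin (Θ t)) fun t ht => by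
    refine (((hAB t ht).2.mul (hΘd t ht).cos).sub
      ((hAB t ht).1.mul (hΘd t ht).sin)).congr_deriv ?_
    ring
  simp only [hΘa, Real.cos_zero, Real.sin_zero, mul_one, mul_zero, add_zero, sub_zero] at h1 h2
  have hcs := Real.sin_sq_add_cos_sq (Θ b)
  have hA1 : A b = Real.cos (Θ b) * A a - Real.sin (Θ b) * B a := by
    rw [← h1, ← h2]
    linear_combination -(A b) * hcs
  have hB1 : B b = Real.sin (Θ b) * A a + Real.cos (Θ b) * B a := by
    rw [← h1, ← h2]
    linear_combination -(B b) * hcs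
  have h := he.eq_of_mem_normalSpace hx hb (hν.normal b hb)
  rw [h]
  exact congrArg₂ (· + ·) (congrArg (· • e 0 b) hA1) (congrArg (· • e 1 b) hB1)

/-- The system for the coefficients is a plane rotation at the given rate, so rotating the initial
coefficients by `Θ` solves it explicitly. -/
theorem exists_parallel (hx : IsRegularCurve x a b) (he : IsAdaptedFrame g x a b e) (α β : ℝ) :
    ∃ ν : ∀ t, Tan (x t), IsNormalParallel g x a b ν ∧ ν a = α • e 0 a + β • e 1 a := by
  set Θ : ℝ → ℝ := rotationAngle g x a b hx.lt.le e with hΘ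
  have hΘa : Θ a = 0 := rotationAngle_left hx.lt.le
  have hΘc : ContDiff ℝ 1 Θ := he.contDiff_rotationAngle hx.lt
  have hΘd : ∀ t ∈ Icc a b, HasDerivWithinAt Θ (rotationRate g x a b e t) (Icc a b) t :=
    fun t ht => he.hasDerivWithinAt_rotationAngle hx.lt ht
  set A : ℝ → ℝ := fun t => α * Real.cos (Θ t) - β * Real.sin (Θ t) with hA
  set B : ℝ → ℝ := fun t => α * Real.sin (Θ t) + β * Real.cos (Θ t) with hB
  have hAc : ContDiff ℝ 1 A :=
    (contDiff_const.mul hΘc.cos).sub (contDiff_const.mul hΘc.sin)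
  have hBc : ContDiff ℝ 1 B :=
    (contDiff_const.mul hΘc.sin).add (contDiff_const.mul hΘc.cos)
  set ν : ∀ t, Tan (x t) := fun t => A t • e 0 t + B t • e 1 t with hν
  have hsmooth : ContMDiffOn 𝓘(ℝ) (𝓡 3).tangent 1 (fun t => (⟨x t, ν t⟩ : TM M)) (Icc a b) :=
    contMDiffOn_add_field (n := 1) (contMDiffOn_smul_field (n := 1) hAc.contDiffOn (he.smooth 0))
      (contMDiffOn_smul_field (n := 1) hBc.contDiffOn (he.smooth 1))
  have hinner : ∀ t ∈ Icc a b, ∀ i, g.inner (x t) (e i t) (ν t) =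
      A t * (if i = 0 then 1 else 0) + B t * (if i = 1 then 1 else 0) := by
    intro t ht i
    rw [hν, map_add, map_smul, map_smul, he.orthonormal t ht, he.orthonormal t ht, smul_eq_mul,
      smul_eq_mul]
  have hn : ∀ t ∈ Icc a b, ν t ∈ normalSpace g x a b t := by
    intro t ht
    rw [he.mem_normalSpace_iff hx ht, hinner t ht]
    simp
  have h0 : ∀ t ∈ Icc a b, g.inner (x t) (e 0 t) (ν t) = A t := fun t ht => by
    rw [hinner t ht]
    simp
  have h1 : ∀ t ∈ Icc a b, g.inner (x t) (e 1 t) (ν t) = B t := fun t ht => by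
    rw [hinner t ht]
    simp
  refine ⟨ν, ⟨hsmooth, hn, fun t ht => ?_⟩, ?_⟩
  · obtain ⟨hd0, hd1⟩ := he.hasDerivWithinAt_components hx ht
      ((hsmooth t ht).mdifferentiableWithinAt one_ne_zero) (hn t ht)
    have hud := uniqueDiffOn_Icc hx.lt t ht
    -- Each coefficient has two expressions for its derivative, from the frame and from the explicit
    -- formula. They differ by the component of `∇ν` along `e i`, which therefore vanishes.
    have e0 := hud.eq_deriv _ (hd0.congr (fun r hr => (h0 r hr).symm) (h0 t ht).symm)
      (((hΘd t ht).cos.const_mul α).sub ((hΘd t ht).sin.const_mul β))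
    have e1 := hud.eq_deriv _ (hd1.congr (fun r hr => (h1 r hr).symm) (h1 t ht).symm)
      (((hΘd t ht).sin.const_mul α).add ((hΘd t ht).cos.const_mul β))
    rw [h1 t ht] at e0
    rw [h0 t ht] at e1
    have z0 : g.inner (x t) (e 0 t) (covDeriv g x a b ν t) = 0 := by
      linear_combination e0
    have z1 : g.inner (x t) (e 1 t) (covDeriv g x a b ν t) = 0 := by
      linear_combination e1
    have hsum := eq_sum_of_orthonormal g (he.orthonormal t ht) (covDeriv g x a b ν t)
    rw [z0, z1, zero_smul, zero_smul, zero_add, zero_add] at hsum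
    rw [normalCovDeriv, sub_eq_zero, ← he.third t ht, g.symm]
    exact hsum
  · simp [hν, hA, hB, hΘa]

end IsAdaptedFrame

/-! ### The total torsion -/

namespace IsAdaptedFrame

variable {g : Metric3 M} {x : ℝ → M} {a b : ℝ} {e : Fin 3 → ∀ t, Tan (x t)}

theorem combination_mem_normalSpace (hx : IsRegularCurve x a b) (he : IsAdaptedFrame g x a b e)
    {t : ℝ} (ht : t ∈ Icc a b) (α β : ℝ) : α • e 0 t + β • e 1 t ∈ normalSpace g x a b t := by
  rw [he.mem_normalSpace_iff hx ht, map_add, map_smul, map_smul, he.orthonormal t ht,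
    he.orthonormal t ht]
  simp

theorem combination_inj (he : IsAdaptedFrame g x a b e) {t : ℝ} (ht : t ∈ Icc a b)
    {α β α' β' : ℝ} (h : α • e 0 t + β • e 1 t = α' • e 0 t + β' • e 1 t) : α = α' ∧ β = β' := by
  have h0 := congrArg (g.inner (x t) (e 0 t)) h
  have h1 := congrArg (g.inner (x t) (e 1 t)) h
  simp only [map_add, map_smul, he.orthonormal t ht] at h0 h1
  exact ⟨by simpa using h0, by simpa using h1⟩

/-- The coordinates on the normal plane given by the first two vectors of an adapted frame. -/
def normalCoord (hx : IsRegularCurve x a b) (he : IsAdaptedFrame g x a b e) {t : ℝ}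
    (ht : t ∈ Icc a b) : normalSpace g x a b t ≃ₗ[ℝ] ℝ × ℝ where
  toFun v := (g.inner (x t) (e 0 t) v.1, g.inner (x t) (e 1 t) v.1)
  map_add' v w := by simp
  map_smul' c v := by simp
  invFun z := ⟨z.1 • e 0 t + z.2 • e 1 t, he.combination_mem_normalSpace hx ht z.1 z.2⟩
  left_inv v := Subtype.ext (he.eq_of_mem_normalSpace hx ht v.2).symm
  right_inv z := by
    simp only [map_add, map_smul, he.orthonormal t ht]
    simp

theorem normalCoord_symm_apply (hx : IsRegularCurve x a b) (he : IsAdaptedFrame g x a b e) {t : ℝ}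
    (ht : t ∈ Icc a b) (z : ℝ × ℝ) :
    ((he.normalCoord hx ht).symm z).1 = z.1 • e 0 t + z.2 • e 1 t := rfl

/-- The rotation of the plane by an angle. -/
def planeRotation (θ : ℝ) : ℝ × ℝ →ₗ[ℝ] ℝ × ℝ where
  toFun z := (Real.cos θ * z.1 - Real.sin θ * z.2, Real.sin θ * z.1 + Real.cos θ * z.2)
  map_add' z w := by
    ext
    · simp
      ring
    · simp
      ring
  map_smul' c z := by
    ext
    · simp
      ring
    · simp
      ring

/-- In the coordinates given by the endpoint frames, `h` is the identity and `P` is the rotation by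
the rotation angle. Both existence and uniqueness of the torsion follow. -/
theorem isTotalTorsion_iff (hx : IsRegularCurve x a b) (he : IsAdaptedFrame g x a b e)
    {A : TripleFiber (x a)} {B : TripleFiber (x b)} (hA0 : A.1 = e 0 a) (hA1 : A.2.1 = e 1 a)
    (hB0 : B.1 = e 0 b) (hB1 : B.2.1 = e 1 b) (θ : Real.Angle) :
    IsTotalTorsion g x a b A B θ ↔ θ = (rotationAngle g x a b hx.lt.le e b : Real.Angle) := by
  have ha : a ∈ Icc a b := left_mem_Icc.2 hx.lt.le
  have hb : b ∈ Icc a b := right_mem_Icc.2 hx.lt.le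
  set Θ : ℝ := rotationAngle g x a b hx.lt.le e b with hΘ
  constructor
  · rintro ⟨h, P, ⟨⟨v, hv, hhv⟩, ⟨w, hw, hhw⟩⟩, hP, ⟨⟨v', hv', hR⟩, -⟩⟩
    obtain rfl : v' = v := Subtype.ext (hv'.trans hv.symm)
    obtain ⟨ν, hν, hνa, hνb⟩ := hP v'
    have hPv := he.parallel_right hx hν
    -- The transport of the first frame vector alone determines the cosine and sine of `θ`, hence
    -- `θ` modulo `2π`.
    rw [hνa, hv, hA0, he.orthonormal a ha, he.orthonormal a ha, if_pos rfl,
      if_neg (by decide), mul_one, mul_zero, mul_one, mul_zero, sub_zero, add_zero, hνb] at hPv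
    have hh : P v' = h (Real.cos Θ • v' + Real.sin Θ • w) := by
      refine Subtype.ext ?_
      rw [hPv, map_add, map_smul, map_smul]
      change _ = Real.cos Θ • (h v').1 + Real.sin Θ • (h w).1
      rw [hhv, hhw, hB0, hB1]
    have hR' : h.symm (P v') = Real.cos Θ • v' + Real.sin Θ • w := by
      rw [hh, LinearEquiv.symm_apply_apply]
    have hR2 : (h.symm (P v')).1 = θ.cos • A.1 + θ.sin • A.2.1 := hR
    rw [hR', hA0, hA1] at hR2
    have hR3 : Real.cos Θ • e 0 a + Real.sin Θ • e 1 a = θ.cos • e 0 a + θ.sin • e 1 a := by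
      rw [← hR2, ← hA0, ← hA1, ← hv, ← hw]
      rfl
    obtain ⟨hc, hs⟩ := he.combination_inj ha hR3
    induction θ using Real.Angle.induction_on with
    | _ θ => exact (Real.Angle.cos_sin_inj hc hs).symm
  · rintro rfl
    -- The witnesses are the identity for `h` and `planeRotation Θ` for `P`, both conjugated by the
    -- frame coordinates.
    refine ⟨(he.normalCoord hx ha).trans (he.normalCoord hx hb).symm,
      (he.normalCoord hx hb).symm.toLinearMap ∘ₗ planeRotation Θ ∘ₗ
        (he.normalCoord hx ha).toLinearMap, ?_, ?_, ?_⟩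
    · refine ⟨⟨(he.normalCoord hx ha).symm (1, 0), ?_, ?_⟩,
        ⟨(he.normalCoord hx ha).symm (0, 1), ?_, ?_⟩⟩
      · simp [normalCoord_symm_apply, hA0]
      · simp [normalCoord_symm_apply, hB0]
      · simp [normalCoord_symm_apply, hA1]
      · simp [normalCoord_symm_apply, hB1]
    · intro v
      obtain ⟨ν, hν, hνa⟩ := he.exists_parallel hx (g.inner (x a) (e 0 a) v.1)
        (g.inner (x a) (e 1 a) v.1)
      rw [← he.eq_of_mem_normalSpace hx ha v.2] at hνa
      refine ⟨ν, hν, hνa, ?_⟩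
      rw [he.parallel_right hx hν, hνa]
      rfl
    · refine ⟨⟨(he.normalCoord hx ha).symm (1, 0), ?_, ?_⟩,
        ⟨(he.normalCoord hx ha).symm (0, 1), ?_, ?_⟩⟩
      · simp [normalCoord_symm_apply, hA0]
      · simp [normalCoord_symm_apply, planeRotation, hA0, hA1]
      · simp [normalCoord_symm_apply, hA1]
      · simp [normalCoord_symm_apply, planeRotation, hA0, hA1]

end IsAdaptedFrame

end ConfThree

end

/-! ### The Kropina length as twice the total torsion. -/

theorem proposition5p11 {M : Type*} [TopologicalSpace M]
    [ChartedSpace (EuclideanSpace ℝ (Fin 3)) M] [IsManifold (𝓡 3) ∞ M]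
    (g : ConfThree.Metric3 M) (o : ConfThree.ManifoldOrientation M)
    (x : ℝ → M) (a b : ℝ) (hx : ConfThree.IsRegularCurve x a b)
    (U : Set (ConfThree.TM M)) (s : ∀ v : ConfThree.TM M, ConfThree.TripleFiber v.proj)
    (hs : ConfThree.IsLocalSection g o U s)
    (hU : ∀ t ∈ Icc a b, ConfThree.lift g x a b t ∈ U) :
    -- the Kropina metric is defined along the lift, and the functional is a convergent integral
    (∀ t ∈ Icc a b, ConfThree.kropinaDenom g U s (ConfThree.lift g x a b t)
        (ConfThree.liftVelocity g x a b t) ≠ 0) ∧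
    IntervalIntegrable (fun t => ConfThree.kropina g U s (ConfThree.lift g x a b t)
        (ConfThree.liftVelocity g x a b t)) MeasureTheory.volume a b ∧
    -- the total torsion is well defined
    (∃! θ : Real.Angle, ConfThree.IsTotalTorsion g x a b
        (s (ConfThree.lift g x a b a)) (s (ConfThree.lift g x a b b)) θ) ∧
    -- the congruence modulo `2π`
    (ConfThree.kropinaLength g U s x a b : Real.Angle) =
      (2 : ℕ) • ConfThree.totalTorsion g x a b
        (s (ConfThree.lift g x a b a)) (s (ConfThree.lift g x a b b)) := by
  have he := ConfThree.isAdaptedFrame_sectionFrame hx hs hU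
  have htors := he.isTotalTorsion_iff hx (A := s (ConfThree.lift g x a b a))
    (B := s (ConfThree.lift g x a b b)) rfl rfl rfl rfl
  have hunique : ∃! θ : Real.Angle, ConfThree.IsTotalTorsion g x a b
      (s (ConfThree.lift g x a b a)) (s (ConfThree.lift g x a b b)) θ :=
    ⟨_, (htors _).2 rfl, fun θ hθ => (htors θ).1 hθ⟩
  have hcongr : ∀ t ∈ uIcc a b, ConfThree.kropina g U s (ConfThree.lift g x a b t)
      (ConfThree.liftVelocity g x a b t) =
        2 * ConfThree.rotationRate g x a b (ConfThree.sectionFrame g x a b s) t := by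
    intro t ht
    rw [uIcc_of_le hx.lt.le] at ht
    exact ConfThree.kropina_section hx hs hU ht
  refine ⟨fun t ht => ?_, ?_, hunique, ?_⟩
  · rw [ConfThree.kropinaDenom_section hx hs hU ht]
    exact (ConfThree.length_pos g (hx.velocity_ne_zero t ht)).ne'
  · refine ContinuousOn.intervalIntegrable (ContinuousOn.congr (f := fun t =>
      2 * ConfThree.rotationRate g x a b (ConfThree.sectionFrame g x a b s) t) ?_ hcongr)
    rw [uIcc_of_le hx.lt.le]
    exact continuousOn_const.mul (he.continuousOn_rotationRate hx.lt)
  -- Existence makes the choice in `totalTorsion` a genuine torsion angle, which must then be the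
  -- integral of the rotation rate.
  · have hval : ConfThree.totalTorsion g x a b (s (ConfThree.lift g x a b a))
        (s (ConfThree.lift g x a b b)) = _ :=
      (htors _).1 (Classical.epsilon_spec hunique.exists)
    rw [hval, ConfThree.kropinaLength, intervalIntegral.integral_congr hcongr,
      intervalIntegral.integral_const_mul, ConfThree.IsAdaptedFrame.rotationAngle_right,
      two_nsmul, ← Real.Angle.coe_add, two_mul]
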